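/- Let $r\ge 1$ and let $m_1,\dots,m_r\ge 0$ be integers with $m_1+\dots+m_r=2g-2$. Let $\mathcal H(m_1,\dots,m_r)$ be the stratum of Abelian differentials in genus $g$ with zeros $P_1,\dots,P_r$ of orders $m_1,\dots,m_r$; the zeros are numbered (labeled), and a zero of order $0$ is a marked point. Let $d=2g+r-1$ be its complex dimension. A square-tiled surface in the stratum is a connected translation surface in it that is glued from unit squares (with all $P_i$ at corners of squares); these surfaces are taken up to isomorphisms of translation surfaces that preserve the numbering of the $P_i$. Cutting such a surface along all horizontal saddle connections (horizontal segments joining points $P_i$) decomposes it into maximal horizontal cylinders. Let $\operatorname{card}\mathcal L_{\mathbb Z,1}(N)$ be the number of square-tiled surfaces in the stratum that have exactly one maximal horizontal cylinder and are tiled with at most $N$ unit squares. Then the absolute contribution $$c_1=2d\cdot\lim_{N\to\infty}\frac{\operatorname{card}\mathcal L_{\mathbb Z,1}(N)}{N^d}$$ of the $1$-cylinder square-tiled surfaces to the Masur–Veech volume $\operatorname{Vol}\mathcal H(m_1,\dots,m_r)$ exists and equals $$c_1=\frac{2}{n!}\cdot\prod_k\frac{1}{(k+1)^{\mu_k}}\cdot\sum_{j=0}^{n-1}j!\,(n-1-j)!\,\chi_j(\nu)\cdot\zeta(n+1).$$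 Here $n=(m_1+1)+\dots+(m_r+1)=d-1$; $\mu_k$ is the number of indices $i$ with $m_i=k$; $\nu\in S_n$ is any permutation whose cycles (fixed points included) have lengths $m_1+1,\dots,m_r+1$; and $\chi_j$ is the character of the $j$-th exterior power $\wedge^j W_n$ of the standard representation of $S_n$ on $W_n=\{x\in\mathbb C^n:\sum_i x_i=0\}$. -/

import Mathlib

namespace SquareTiled

open Equiv

/-- The vertices of the surface glued from the squares `Fin M`, where the right side of `s` is glued
to the left side of `right s` and the top side of `s` to the bottom side of `up s`.  A vertex
is the class of its bottom-left corners: turning once (by `2π`) around the bottom-left corner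
of `s` leads through `right⁻¹ s`, `up⁻¹ (right⁻¹ s)`, `right (up⁻¹ (right⁻¹ s))` to the bottom-left
corner of `up (right (up⁻¹ (right⁻¹ s)))`. -/
abbrev Vertex {M : ℕ} (right up : Perm (Fin M)) : Type :=
  Quotient (Perm.SameCycle.setoid (up * right * up⁻¹ * right⁻¹))

/-- The number of bottom-left corners of squares at the vertex `p`; the cone angle at `p`
is `2π` times this number. -/
noncomputable def multiplicity {M : ℕ} {right up : Perm (Fin M)} (p : Vertex right up) : ℕ :=
  Nat.card {s : Fin M // (⟦s⟧ : Vertex right up) = p}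

/-- A connected translation surface in the stratum `H(m 0, …, m (r - 1))`, with numbered zeros,
tiled by `M` unit squares that are numbered by `Fin M`. A zero of order `m i`
is a vertex of cone angle `2π (m i + 1)`; orders `m i = 0` (marked points) are allowed. -/
structure Surface {r : ℕ} (m : Fin r → ℕ) (M : ℕ) where
  /-- The right neighbour of a square. -/
  right : Perm (Fin M)
  /-- The top neighbour of a square. -/
  up : Perm (Fin M)
  /-- The surface is connected. -/
  connected : MulAction.IsPretransitive (Subgroup.closure {right, up}) (Fin M)
  /-- The numbered zeros and marked points. -/
  zero : Fin r → Vertex right up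
  zero_injective : Function.Injective zero
  multiplicity_zero : ∀ i, multiplicity (zero i) = m i + 1
  /-- All other points are regular. -/
  multiplicity_other : ∀ p : Vertex right up, p ∉ Set.range zero → multiplicity p = 1

namespace Surface

variable {r : ℕ} {m : Fin r → ℕ} {M : ℕ}

/-- `f` is an isomorphism of translation surfaces that preserves the numbering of the zeros. -/
def IsIso (S T : Surface m M) (f : Perm (Fin M)) : Prop :=
  (∀ s, f (S.right s) = T.right (f s)) ∧ (∀ s, f (S.up s) = T.up (f s)) ∧
    ∀ i s, (⟦s⟧ : Vertex S.right S.up) = S.zero i ↔ (⟦f s⟧ : Vertex T.right T.up) = T.zero i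

/-- Isomorphism of square-tiled surfaces: the numbering of the squares is forgotten. -/
instance isoSetoid (m : Fin r → ℕ) (M : ℕ) : Setoid (Surface m M) where
  r S T := ∃ f : Perm (Fin M), S.IsIso T f
  iseqv :=
    { refl := fun _ => ⟨1, fun _ => rfl, fun _ => rfl, fun _ _ => Iff.rfl⟩
      symm := by
        rintro S T ⟨f, h1, h2, h3⟩
        refine ⟨f⁻¹, fun s => ?_, fun s => ?_, fun i s => ?_⟩
        · rw [Perm.inv_eq_iff_eq, h1]; simp
        · rw [Perm.inv_eq_iff_eq, h2]; simp
        · rw [h3]; simp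
      trans := by
        rintro S T U ⟨f, h1, h2, h3⟩ ⟨g, k1, k2, k3⟩
        refine ⟨g * f, fun s => ?_, fun s => ?_, fun i s => ?_⟩
        · simp [h1, k1]
        · simp [h2, k2]
        · rw [h3, k3]; rfl }

/-- The closed horizontal line through the bottom sides of the row of squares of `s` contains
a zero or a marked point, so it consists of saddle connections. -/
def BottomCritical (S : Surface m M) (s : Fin M) : Prop :=
  ∃ (k : ℤ) (i : Fin r), (⟦(S.right ^ k) s⟧ : Vertex S.right S.up) = S.zero i

/-- The maximal horizontal cylinders, as classes of squares: neighbours in a horizontal row lie in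
the same cylinder, and so do a square and its upper neighbour
if the horizontal line between them is not critical. -/
def Cylinder (S : Surface m M) : Type :=
  Quot fun s t : Fin M => t = S.right s ∨ (t = S.up s ∧ ¬ S.BottomCritical t)

/-- The number of maximal horizontal cylinders. -/
noncomputable def numCylinders (S : Surface m M) : ℕ := Nat.card S.Cylinder

end Surface

/-- The number of isomorphism classes of square-tiled surfaces in `H(m 0, …, m (r - 1))`
with numbered zeros, exactly `k` maximal horizontal cylinders, and at most `N` unit squares. -/
noncomputable def count {r : ℕ} (m : Fin r → ℕ) (k N : ℕ) : ℕ :=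
  ∑ M ∈ Finset.Icc 1 N,
    ((Quotient.mk (Surface.isoSetoid m M)) '' {S : Surface m M | S.numCylinders = k}).ncard

/-- `c` is the absolute contribution `c_k` of the `k`-cylinder square-tiled surfaces to the
Masur–Veech volume of the stratum `H(m 0, …, m (r - 1))` of complex dimension `d`:
`c = 2 d · lim count(N) / N ^ d`. -/
def IsContribution {r : ℕ} (m : Fin r → ℕ) (d k : ℕ) (c : ℝ) : Prop :=
  Filter.Tendsto (fun N : ℕ => 2 * (d : ℝ) * ((count m k N : ℝ) / (N : ℝ) ^ d))
    Filter.atTop (nhds c)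

/-- The permutation representation of `S_n` on `ℂ ^ n`; `g` maps `e_i` to `e_(g i)`. -/
def permRep (n : ℕ) : Representation ℂ (Perm (Fin n)) (Fin n → ℂ) where
  toFun g := LinearMap.funLeft ℂ ℂ ⇑g⁻¹
  map_one' := rfl
  map_mul' g h := by ext; simp [LinearMap.funLeft]

/-- The invariant subspace of vectors with coordinate sum zero. -/
def stdSub (n : ℕ) : Subrepresentation (permRep n) where
  toSubmodule := LinearMap.ker (∑ i : Fin n, LinearMap.proj i : (Fin n → ℂ) →ₗ[ℂ] ℂ)
  apply_mem_toSubmodule g v hv := by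
    simp only [LinearMap.mem_ker, LinearMap.sum_apply, LinearMap.proj_apply] at hv ⊢
    rw [← hv]
    exact Equiv.sum_comp g⁻¹ v

/-- The standard representation of `S_n`, of dimension `n - 1`. -/
def stdRep (n : ℕ) : Representation ℂ (Perm (Fin n)) (stdSub n).toSubmodule :=
  (stdSub n).toRepresentation

/-- The `j`-th exterior power of the standard representation of `S_n`. -/
noncomputable def extStdRep (n j : ℕ) :
    Representation ℂ (Perm (Fin n)) (⋀[ℂ]^j (stdSub n).toSubmodule) where
  toFun g := exteriorPower.map j (stdRep n g)
  map_one' := by rw [map_one]; exact exteriorPower.map_id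
  map_mul' g h := by rw [map_mul]; exact exteriorPower.map_comp _ _

/-- The character `χ_j` of the `j`-th exterior power of the standard representation of `S_n`. -/
noncomputable def chi (n j : ℕ) (g : Perm (Fin n)) : ℂ := (extStdRep n j).character g

/-- The number `μ_k` of zeros of order `k`. -/
def mult {r : ℕ} (m : Fin r → ℕ) (k : ℕ) : ℕ := (Finset.univ.filter fun i => m i = k).card

end SquareTiled

/-! Why the theorem is true.

A surface with one cylinder consists of `h` rows of `w` squares, and all zeros lie on the
horizontal line along which the top of the cylinder is glued to its bottom. Collapsing the height
from `h` to `1` therefore gives a bijection between isomorphism classes of one-cylinder surfaces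
with `M` squares and pairs of a divisor `w` of `M` and an isomorphism class of surfaces that
consist of a single row of `w` squares (`ncard_oneCylinder`). The number `numRow m w` of the
latter is computed with Burnside's lemma. A labelled row surface is a pair `(R, U)` of
permutations of `w` points with `R` a full cycle, and the turn `α = U R U⁻¹ R⁻¹` around the
corners has one cycle of length `m i + 1` for each zero and fixes all other points. Since `U R U⁻¹
= α R`, the surface amounts to a choice of the corners at the zeros, of a full cycle `R` such that
`α R` is a full cycle, too, and of one of the `w` conjugations of `R` to `α R` (`basedRowEquiv`,
`card_rowSurface`). Deleting the fixed points of `α` one by one (`numFull_optionCongr`) reduces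
the count of such `R` to the count `numFull ν` of the full cycles `ρ` in `S_n` for which `ν ρ` is
a full cycle. Surfaces with a nontrivial automorphism are negligible (`card_symmetric_le`),
because the corners at the zeros are permuted by it and one of them is determined by the others.
Hence `numRow m w` grows like `numFull ν / (∏ (m i + 1) (n - 1)!) w ^ n` (`tendsto_numRow`).

The number `numFull ν` is given by Frobenius' formula (`numFull_eq`). Only the hook characters
`χ_j` enter: `∑ (-1) ^ j χ_j g` is the value at `1` of the characteristic polynomial of `g` on the
standard representation `W`, which is `n` if `g` is a full cycle, and `0` otherwise (`sum_chi`).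
The sum of all full cycles is central and acts on `∧^j W` as a scalar by Schur's lemma
(`eq_smul_of_commute`, which is proved directly with the transpositions `(0 i)`), and the trace
identifies the scalar as `(-1) ^ j j! (n - 1 - j)!` (`sum_chi_mul`).

Finally the sum of `a w ^ n` over all `w h ≤ N` is asymptotic to `a ζ(n + 1) N ^ (n + 1) / (n +
1)` (`tendsto_sum_divisors`), which produces the factor `ζ(n + 1)`.
-/

namespace SquareTiled

open Equiv

/-! ### Full cycles -/

/-- A permutation of `X` is a full cycle if all of `X` is a single orbit.  In contrast to
`Equiv.Perm.IsCycle`, this includes the identity of a type with one element. -/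
def IsFullCycle {X : Type*} (σ : Perm X) : Prop := ∀ x y, σ.SameCycle x y

section FullCycle

variable {X Y : Type*}

lemma permCongr_zpow (e : X ≃ Y) (σ : Perm X) (k : ℤ) :
    (e.permCongr σ) ^ k = e.permCongr (σ ^ k) :=
  (map_zpow e.permCongrHom σ k).symm

lemma permCongr_mul' (e : X ≃ Y) (σ τ : Perm X) :
    e.permCongr (σ * τ) = e.permCongr σ * e.permCongr τ :=
  map_mul e.permCongrHom σ τ

lemma permCongr_inv' (e : X ≃ Y) (σ : Perm X) :
    e.permCongr σ⁻¹ = (e.permCongr σ)⁻¹ :=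
  map_inv e.permCongrHom σ

lemma sameCycle_permCongr (e : X ≃ Y) (σ : Perm X) (x y : X) :
    (e.permCongr σ).SameCycle (e x) (e y) ↔ σ.SameCycle x y := by
  simp [Perm.SameCycle, permCongr_zpow]

lemma isFullCycle_permCongr (e : X ≃ Y) (σ : Perm X) :
    IsFullCycle (e.permCongr σ) ↔ IsFullCycle σ := by
  constructor
  · intro h x y
    exact (sameCycle_permCongr e σ x y).1 (h _ _)
  · intro h x y
    have := (sameCycle_permCongr e σ (e.symm x) (e.symm y)).2 (h _ _)
    simpa using this

lemma IsFullCycle.conj {σ : Perm X} (h : IsFullCycle σ) (f : Perm X) :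
    IsFullCycle (f * σ * f⁻¹) :=
  (isFullCycle_permCongr f σ).2 h

/-- A function that is invariant under a full cycle is constant. -/
lemma IsFullCycle.eq_of_invariant {σ : Perm X} (h : IsFullCycle σ) {C : Type*} (f : X → C)
    (hf : ∀ x, f (σ x) = f x) (x y : X) : f x = f y := by
  obtain ⟨k, rfl⟩ := h x y
  have hz : ∀ k : ℤ, f ((σ ^ k) x) = f x := by
    intro k
    induction k using Int.induction_on with
    | zero => simp
    | succ i ih => rw [add_comm, zpow_add, zpow_one, Perm.mul_apply, hf, ih]
    | pred i ih =>
      rw [← ih, ← hf, ← Perm.mul_apply, ← zpow_one_add]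
      congr 3; ring
  exact (hz k).symm

/-- A permutation is a full cycle if no proper nonempty subset is invariant. -/
lemma isFullCycle_of_invariant {σ : Perm X}
    (h : ∀ f : X → Prop, (∀ x, f (σ x) = f x) → ∀ x y, f x → f y) : IsFullCycle σ := by
  intro x y
  refine h (fun z => σ.SameCycle x z) (fun z => ?_) x y (Perm.SameCycle.refl _ _)
  exact propext Perm.sameCycle_apply_right

/-- Inserting a new point into a cyclic arrangement before the point `x`. -/
lemma isFullCycle_swap_mul_optionCongr [DecidableEq X] (x : X) (ρ : Perm X) :
    IsFullCycle (swap none (some x) * optionCongr ρ) ↔ IsFullCycle ρ := by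
  have hσ : ∀ y, (swap none (some x) * optionCongr ρ) (some y) =
      if ρ y = x then none else some (ρ y) := by
    intro y
    by_cases hy : ρ y = x
    · simp [hy]
    · simp only [Perm.mul_apply, optionCongr_apply, Option.map_some, if_neg hy]
      exact swap_apply_of_ne_of_ne (by simp) (by simpa using hy)
  have hn : (swap none (some x) * optionCongr ρ) none = some x := by simp
  constructor
  · intro h
    refine isFullCycle_of_invariant fun f hf y z hy => ?_
    have key := h.eq_of_invariant (fun o : Option X => o.elim (f x) f) (by
      rintro (_ | w)
      · simp only [hn]; rfl
      · rw [hσ]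
        split_ifs with hw
        · simp only [Option.elim_none, Option.elim_some, ← hf w, hw]
        · simp only [Option.elim_some, hf]) (some y) (some z)
    simpa [hy] using key
  · intro h
    refine isFullCycle_of_invariant fun f hf => ?_
    have hc : ∀ y, f (some y) = f none := by
      have hinv : ∀ y, f (some (ρ y)) = f (some y) := by
        intro y
        rw [← hf (some y), hσ]
        split_ifs with hy
        · rw [hy, ← hf none, hn]
        · rfl
      intro y
      rw [h.eq_of_invariant (fun z => f (some z)) hinv y x, ← hf none, hn]
    rintro (_ | y) (_ | z) hy <;> simp_all

lemma not_isFullCycle_optionCongr [Nonempty X] (ρ : Perm X) : ¬ IsFullCycle (optionCongr ρ) := by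
  intro h
  obtain ⟨x⟩ := ‹Nonempty X›
  have := h.eq_of_invariant (fun o : Option X => o.isSome) (by rintro (_ | _) <;> simp)
    none (some x)
  simp at this

/-- The number of full cycles `ρ` such that `α * ρ` is a full cycle, too. -/
noncomputable def numFull (α : Perm X) : ℕ :=
  Nat.card {ρ : Perm X // IsFullCycle ρ ∧ IsFullCycle (α * ρ)}

lemma numFull_permCongr (e : X ≃ Y) (α : Perm X) : numFull (e.permCongr α) = numFull α := by
  refine (Nat.card_congr (e.permCongr.subtypeEquiv fun ρ => ?_)).symm
  rw [← permCongr_mul', isFullCycle_permCongr, isFullCycle_permCongr]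

/-- A fixed point of `α` can be deleted from two full cycles `ρ` and `α * ρ`: it has the same
predecessor in both of them, which can be any of the other points. -/
lemma numFull_optionCongr [Nonempty X] (α : Perm X) :
    numFull (optionCongr α) = Nat.card X * numFull α := by
  classical
  have hmul : ∀ (x : X) (ρ : Perm X), optionCongr α * (swap none (some x) * optionCongr ρ) =
      swap none (some (α x)) * optionCongr (α * ρ) := by
    intro x ρ
    rw [← mul_assoc, Perm.mul_def (optionCongr α), ← Perm.mul_def, mul_swap_eq_swap_mul, mul_assoc]
    congr 1
    ext (_ | y) <;> simp
  unfold numFull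
  rw [← Nat.card_prod]
  symm
  refine Nat.card_congr (Equiv.ofBijective
    (fun p => ⟨swap none (some p.1) * optionCongr p.2.1, ?_, ?_⟩) ⟨?_, ?_⟩)
  · exact (isFullCycle_swap_mul_optionCongr _ _).2 p.2.2.1
  · rw [hmul]
    exact (isFullCycle_swap_mul_optionCongr _ _).2 p.2.2.2
  · rintro ⟨x, ρ, h1⟩ ⟨y, τ, h2⟩ h
    have h' := congrArg Subtype.val h
    have := Perm.decomposeOption.symm.injective (a₁ := (some x, ρ)) (a₂ := (some y, τ)) h'
    simpa using this
  · rintro ⟨σ, h1, h2⟩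
    obtain ⟨⟨o, ρ⟩, rfl⟩ := Perm.decomposeOption.symm.surjective σ
    rcases o with _ | x
    · exfalso
      refine not_isFullCycle_optionCongr ρ ?_
      have h1' : IsFullCycle (swap none none * optionCongr ρ) := h1
      rwa [swap_self, ← Perm.one_def, one_mul] at h1'
    · refine ⟨⟨x, ρ, (isFullCycle_swap_mul_optionCongr _ _).1 h1, ?_⟩, rfl⟩
      have h2' : IsFullCycle (optionCongr α * (swap none (some x) * optionCongr ρ)) := h2
      rw [hmul] at h2'
      exact (isFullCycle_swap_mul_optionCongr _ _).1 h2'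

lemma numFull_one : numFull (1 : Perm X) = Nat.card {ρ : Perm X // IsFullCycle ρ} := by
  simp [numFull]

/-- There are `(n - 1)!` full cycles on `n` points. -/
lemma card_isFullCycle [Finite X] : Nat.card {ρ : Perm X // IsFullCycle ρ} =
    (Nat.card X - 1).factorial := by
  rw [← numFull_one]
  have key : ∀ n, numFull (1 : Perm (Fin n)) = (n - 1).factorial := by
    intro n
    induction n with
    | zero => simp [numFull, IsFullCycle]
    | succ n ih =>
      rcases Nat.eq_zero_or_pos n with rfl | hn
      · have : ∀ ρ : Perm (Fin 1), IsFullCycle ρ := fun ρ x y => by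
          rw [Subsingleton.elim x y]
        simp [numFull, this]
      · have : Nonempty (Fin n) := ⟨⟨0, hn⟩⟩
        have h := numFull_optionCongr (1 : Perm (Fin n))
        rw [optionCongr_one, ← numFull_permCongr (finSuccEquiv n).symm] at h
        have h1 : (finSuccEquiv n).symm.permCongr 1 = 1 := by ext; simp
        rw [h1, ih, Nat.card_fin] at h
        rw [h, Nat.add_sub_cancel, Nat.mul_factorial_pred hn.ne']
  rw [← key, ← numFull_permCongr (Finite.equivFin X)]
  congr 1
  ext; simp

/-- Adding `k` fixed points to a permutation `α`. -/
lemma numFull_sumCongr [Finite X] [Nonempty X] (α : Perm X) (k : ℕ) :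
    numFull (sumCongr α (1 : Perm (Fin k))) * (Nat.card X - 1).factorial =
      (Nat.card X + k - 1).factorial * numFull α := by
  induction k with
  | zero =>
    rw [← numFull_permCongr (Equiv.sumEmpty X (Fin 0)).symm α, mul_comm]
    congr 2
    ext (x | x)
    · simp
    · exact x.elim0
  | succ k ih =>
    let e : X ⊕ Fin (k + 1) ≃ Option (X ⊕ Fin k) :=
      (Equiv.sumCongr (Equiv.refl X)
        ((finSuccEquiv k).trans (Equiv.optionEquivSumPUnit.{0} _))).trans
        ((Equiv.sumAssoc _ _ _).symm.trans (Equiv.optionEquivSumPUnit.{0} _).symm)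
    have he : e.permCongr (sumCongr α (1 : Perm (Fin (k + 1)))) =
        optionCongr (sumCongr α (1 : Perm (Fin k))) := by
      rw [Equiv.permCongr_def]
      apply Equiv.ext
      rintro (_ | x | x) <;> simp [e]
    have hp : 0 < Nat.card X := Nat.card_pos
    rw [← numFull_permCongr e, he, numFull_optionCongr, mul_assoc, ih, Nat.card_sum, Nat.card_fin,
      ← mul_assoc, Nat.mul_factorial_pred (by omega)]
    rfl

end FullCycle

/-- If `R` and `T` are full cycles on `n` points, then `R` is conjugate to `T` by `n`
permutations. -/
lemma card_conj_eq {X : Type*} [Finite X] [Nonempty X] {R T : Perm X} (hR : IsFullCycle R)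
    (hT : IsFullCycle T) : Nat.card {U : Perm X // U * R * U⁻¹ = T} = Nat.card X := by
  classical
  have := Fintype.ofFinite X
  obtain ⟨o⟩ := ‹Nonempty X›
  have hle : ∀ T : Perm X, Nat.card {U : Perm X // U * R * U⁻¹ = T} ≤ Nat.card X := by
    intro T
    refine Nat.card_le_card_of_injective (fun U => U.1 o) ?_
    rintro ⟨U, hU⟩ ⟨V, hV⟩ h
    simp only at h
    have hU' : ∀ k : ℤ, U * R ^ k = T ^ k * U := by
      intro k
      rw [← hU, conj_zpow]; group
    have hV' : ∀ k : ℤ, V * R ^ k = T ^ k * V := by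
      intro k
      rw [← hV, conj_zpow]; group
    ext x
    obtain ⟨k, rfl⟩ := hR o x
    rw [← Perm.mul_apply, ← Perm.mul_apply, hU', hV', Perm.mul_apply, Perm.mul_apply, h]
  -- the `n!` permutations `U` are distributed over the `(n - 1)!` full cycles `U * R * U⁻¹`
  have hsum : ∑ T : {ρ : Perm X // IsFullCycle ρ}, Nat.card {U : Perm X // U * R * U⁻¹ = T.1} =
      ∑ _T : {ρ : Perm X // IsFullCycle ρ}, Nat.card X := by
    have h1 : ∑ T : {ρ : Perm X // IsFullCycle ρ}, Nat.card {U : Perm X // U * R * U⁻¹ = T.1} =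
        Nat.card (Perm X) := by
      rw [← Nat.card_sigma]
      refine Nat.card_congr ⟨fun p => p.2.1, fun U => ⟨⟨U * R * U⁻¹, hR.conj U⟩, U, rfl⟩,
        ?_, fun _ => rfl⟩
      rintro ⟨⟨T, hT⟩, U, hU⟩
      obtain rfl : U * R * U⁻¹ = T := hU
      rfl
    rw [h1, Finset.sum_const, Finset.card_univ, ← Nat.card_eq_fintype_card, card_isFullCycle,
      Nat.card_perm, smul_eq_mul, mul_comm, Nat.mul_factorial_pred Nat.card_pos.ne']
  exact (Finset.sum_eq_sum_iff_of_le fun T _ => hle T.1).1 hsum ⟨T, hT⟩ (Finset.mem_univ _)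

/-- A permutation that commutes with a full cycle is a power of it. -/
lemma IsFullCycle.exists_zpow {X : Type*} [Nonempty X] {R f : Perm X} (hR : IsFullCycle R)
    (hf : f * R = R * f) : ∃ k : ℤ, f = R ^ k := by
  obtain ⟨o⟩ := ‹Nonempty X›
  obtain ⟨k, hk⟩ := hR o (f o)
  refine ⟨k, ?_⟩
  ext x
  obtain ⟨j, rfl⟩ := hR o x
  have hc : Commute f (R ^ j) := Commute.zpow_right (a := f) (b := R) hf j
  rw [← Perm.mul_apply, hc.eq, Perm.mul_apply, ← hk, ← Perm.mul_apply, ← Perm.mul_apply,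
    ← zpow_add, ← zpow_add, add_comm]

section StandardRepresentation

open Polynomial

/-! ### Exterior powers of the standard representation -/

lemma mem_stdSub {n : ℕ} {v : Fin n → ℂ} : v ∈ (stdSub n).toSubmodule ↔ ∑ i, v i = 0 := by
  change v ∈ LinearMap.ker _ ↔ _
  simp [LinearMap.mem_ker, LinearMap.sum_apply]

/-- The basis `e (a + 1) - e 0` of the standard representation of `S_(k+1)`; the coordinates
of a vector are its entries except for the one with number `0`. -/
noncomputable def stdBasis (k : ℕ) : Module.Basis (Fin k) ℂ (stdSub (k + 1)).toSubmodule :=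
  Module.Basis.ofEquivFun
    { toFun := fun w a => w.1 a.succ
      map_add' := fun _ _ => rfl
      map_smul' := fun _ _ => rfl
      invFun := fun v => ⟨Fin.cons (-∑ a, v a) v, by
        simp [mem_stdSub, Fin.sum_univ_succ]⟩
      left_inv := by
        rintro ⟨w, hw⟩
        have hw' := mem_stdSub.1 hw
        rw [Fin.sum_univ_succ] at hw'
        ext x
        refine Fin.cases ?_ (fun a => ?_) x
        · simp only [Fin.cons_zero]
          linear_combination -hw'
        · simp
      right_inv := fun v => by ext; simp }

lemma stdBasis_coord {k : ℕ} (a : Fin k) (w : (stdSub (k + 1)).toSubmodule) :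
    (stdBasis k).coord a w = w.1 a.succ := rfl

lemma stdBasis_apply_succ {k : ℕ} (a c : Fin k) :
    (stdBasis k a).1 c.succ = if a = c then 1 else 0 := by
  rw [← stdBasis_coord, Module.Basis.coord_apply, Module.Basis.repr_self, Finsupp.single_apply]

lemma stdRep_apply {n : ℕ} (g : Perm (Fin n)) (w : (stdSub n).toSubmodule) (x : Fin n) :
    (stdRep n g w).1 x = w.1 (g⁻¹ x) := rfl

lemma stdSub_ext {k : ℕ} {v w : (stdSub (k + 1)).toSubmodule}
    (h : ∀ a : Fin k, v.1 a.succ = w.1 a.succ) : v = w :=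
  (stdBasis k).ext_elem fun a => h a

lemma stdRep_swap_stdBasis {k : ℕ} (i a : Fin k) :
    stdRep (k + 1) (swap 0 i.succ) (stdBasis k a) =
      if a = i then -stdBasis k i else stdBasis k a - stdBasis k i := by
  have h0 : ∀ a, (stdBasis k a).1 0 = -1 := by
    intro a
    have h := mem_stdSub.1 (stdBasis k a).2
    simp only [Fin.sum_univ_succ, stdBasis_apply_succ, Finset.sum_ite_eq, Finset.mem_univ,
      if_true] at h
    linear_combination h
  apply stdSub_ext
  intro c
  rw [stdRep_apply, swap_inv]
  by_cases hc : c = i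
  · subst hc
    rw [swap_apply_right, h0]
    split_ifs with ha
    · simp [stdBasis_apply_succ]
    · simp [stdBasis_apply_succ, ha]
  · rw [swap_apply_of_ne_of_ne (by simp) (by simpa using hc)]
    split_ifs with ha
    · subst ha; simp [stdBasis_apply_succ, Ne.symm hc]
    · simp [stdBasis_apply_succ, Ne.symm hc]

/-- Subtracting one argument from others does not change the value of an alternating map. -/
lemma alternatingMap_sub_eq {R M N ι : Type*} [CommRing R] [AddCommGroup M] [Module R M]
    [AddCommGroup N] [Module R N] [DecidableEq ι] (F : M [⋀^ι]→ₗ[R] N) (v : ι → M) (l : ι)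
    (S : Finset ι) (hl : l ∉ S) : F (fun r => if r ∈ S then v r - v l else v r) = F v := by
  induction S using Finset.induction_on with
  | empty => simp
  | insert a S ha ih =>
    have hla : l ≠ a := fun h => hl (h ▸ Finset.mem_insert_self _ _)
    have hlS : l ∉ S := fun h => hl (Finset.mem_insert_of_mem h)
    set u : ι → M := fun r => if r ∈ S then v r - v l else v r with hu
    have h1 : (fun r => if r ∈ insert a S then v r - v l else v r) =
        Function.update u a (u a - u l) := by
      ext r
      by_cases hr : r = a
      · subst hr; simp [hu, ha, hlS]
      · simp [hu, hr]
    rw [h1, F.map_update_sub, Function.update_eq_self, F.map_update_self _ hla.symm, sub_zero,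
      ih hlS]

/-- An endomorphism that is diagonal in a basis is a scalar if any two basis vectors are connected
by an endomorphism that commutes with it. -/
lemma eq_smul_of_diagonal {ι V : Type*} [AddCommGroup V] [Module ℂ V] (B : Module.Basis ι ℂ V)
    (A : Module.End ℂ V) (hdiag : ∀ s t, t ≠ s → B.repr (A (B s)) t = 0)
    (hlink : ∀ s t, ∃ ρ : Module.End ℂ V, ρ * A = A * ρ ∧ B.repr (ρ (B s)) t = 1) :
    ∃ c : ℂ, A = c • 1 := by
  have hA1 : ∀ s, A (B s) = B.repr (A (B s)) s • B s := by
    intro s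
    apply B.ext_elem
    intro t
    by_cases hts : t = s
    · subst hts; simp
    · rw [hdiag s t hts, map_smul, Finsupp.smul_apply, Module.Basis.repr_self,
        Finsupp.single_eq_of_ne hts, smul_zero]
  have hcoord : ∀ x t, B.repr (A x) t = B.repr (A (B t)) t * B.repr x t := by
    intro x t
    have : B.coord t ∘ₗ A = B.repr (A (B t)) t • B.coord t := by
      apply B.ext
      intro s
      by_cases hts : t = s
      · subst hts; simp
      · simp only [LinearMap.comp_apply, Module.Basis.coord_apply, LinearMap.smul_apply]
        rw [hdiag s t hts, Module.Basis.repr_self, Finsupp.single_eq_of_ne hts, smul_zero]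
    exact LinearMap.congr_fun this x
  have hconst : ∀ s t, B.repr (A (B s)) s = B.repr (A (B t)) t := by
    intro s t
    obtain ⟨ρ, hρ, h1⟩ := hlink s t
    have h2 : A (ρ (B s)) = B.repr (A (B s)) s • ρ (B s) := by
      rw [← Module.End.mul_apply, ← hρ, Module.End.mul_apply, ← map_smul, ← hA1 s]
    have h3 := hcoord (ρ (B s)) t
    rw [h2, map_smul, Finsupp.smul_apply, h1] at h3
    simpa using h3
  rcases isEmpty_or_nonempty ι with he | ⟨⟨s⟩⟩
  · exact ⟨0, B.ext fun s => he.elim s⟩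
  · refine ⟨B.repr (A (B s)) s, B.ext fun t => ?_⟩
    rw [hA1 t, hconst t s]
    simp

section Ext

variable {k j : ℕ}

/-- The basis of `∧^j W` of exterior products of basis vectors of `W`. -/
noncomputable abbrev extBasis (k j : ℕ) :
    Module.Basis (Set.powersetCard (Fin k) j) ℂ (⋀[ℂ]^j (stdSub (k + 1)).toSubmodule) :=
  (stdBasis k).exteriorPower j

/-- The exterior product `e_s` changes its sign under the transposition of `0` and `i + 1` for
`i ∈ s`. -/
lemma extStdRep_swap_extBasis (s : Set.powersetCard (Fin k) j) (i : Fin k) (hi : i ∈ s) :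
    extStdRep (k + 1) j (swap 0 i.succ) (extBasis k j s) = -extBasis k j s := by
  obtain ⟨l, hl⟩ := (Set.powersetCard.mem_range_ofFinEmbEquiv_symm_iff_mem s i).2 hi
  have hB : extBasis k j s = exteriorPower.ιMulti ℂ j
      (fun r => stdBasis k (Set.powersetCard.ofFinEmbEquiv.symm s r)) := by
    rw [exteriorPower.basis_apply]; rfl
  rw [hB]
  change exteriorPower.map j (stdRep (k + 1) (swap 0 i.succ)) _ = _
  rw [exteriorPower.map_apply_ιMulti]
  set v : Fin j → (stdSub (k + 1)).toSubmodule :=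
    fun r => stdBasis k (Set.powersetCard.ofFinEmbEquiv.symm s r) with hv
  have h1 : (⇑(stdRep (k + 1) (swap 0 i.succ)) ∘ v) =
      Function.update (fun r => if r ∈ Finset.univ.erase l then v r - v l else v r) l
        (-(fun r => if r ∈ Finset.univ.erase l then v r - v l else v r) l) := by
    ext1 r
    simp only [Function.comp_apply, hv, stdRep_swap_stdBasis]
    by_cases hr : r = l
    · subst hr; simp [hl]
    · have : (Set.powersetCard.ofFinEmbEquiv.symm s) r ≠ i := by
        rw [← hl]
        exact fun h => hr ((Set.powersetCard.ofFinEmbEquiv.symm s).injective h)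
      simp [hr, this, hl]
  rw [h1, AlternatingMap.map_update_neg, Function.update_eq_self,
    alternatingMap_sub_eq _ _ _ _ (Finset.notMem_erase _ _)]

/-- The coordinate of `e_t` is not affected by the transposition of `0` and `i + 1` for `i ∉ t`. -/
lemma extBasis_repr_swap (t : Set.powersetCard (Fin k) j) (i : Fin k) (hi : i ∉ t)
    (x : ⋀[ℂ]^j (stdSub (k + 1)).toSubmodule) :
    (extBasis k j).repr (extStdRep (k + 1) j (swap 0 i.succ) x) t = (extBasis k j).repr x t := by
  rw [exteriorPower.basis_repr_apply, exteriorPower.basis_repr_apply]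
  have : (exteriorPower.ιMultiDual ℂ j (stdBasis k) t) ∘ₗ
      exteriorPower.map j (stdRep (k + 1) (swap 0 i.succ)) =
      exteriorPower.ιMultiDual ℂ j (stdBasis k) t := by
    apply exteriorPower.linearMap_ext
    ext v
    simp only [LinearMap.compAlternatingMap_apply, LinearMap.comp_apply,
      exteriorPower.map_apply_ιMulti, exteriorPower.ιMultiDual_apply_ιMulti]
    congr 1
    ext r c
    simp only [Matrix.of_apply, Function.comp_apply, stdBasis_coord, stdRep_apply]
    rw [swap_inv, swap_apply_of_ne_of_ne (by simp)]
    intro h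
    apply hi
    rw [← Fin.succ_injective _ h]
    exact (Set.powersetCard.mem_range_ofFinEmbEquiv_symm_iff_mem t _).1 ⟨c, rfl⟩
  exact LinearMap.congr_fun this x

/-- The matrix of `∧^j f` consists of the minors of the matrix of `f`. -/
lemma extBasis_repr_map (s t : Set.powersetCard (Fin k) j) (f : Module.End ℂ _) :
    (extBasis k j).repr (exteriorPower.map j f (extBasis k j s)) t =
      Matrix.det (Matrix.of fun r c => (stdBasis k).coord (Set.powersetCard.ofFinEmbEquiv.symm t c)
        (f (stdBasis k (Set.powersetCard.ofFinEmbEquiv.symm s r)))) := by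
  rw [exteriorPower.basis_repr_apply, exteriorPower.basis_apply,
    exteriorPower.map_apply_ιMulti_family]
  change exteriorPower.ιMultiDual ℂ j (stdBasis k) t (exteriorPower.ιMulti ℂ j _) = _
  rw [exteriorPower.ιMultiDual_apply_ιMulti]
  rfl

/-- Schur's lemma for `∧^j W`.  The line spanned by the basis vector `e_s` is the space
of vectors that change their sign under the transpositions of `0` and `i + 1` for `i ∈ s`, hence
an equivariant endomorphism is diagonal in this basis. -/
lemma eq_smul_of_commute (A : Module.End ℂ (⋀[ℂ]^j (stdSub (k + 1)).toSubmodule))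
    (hA : ∀ g, extStdRep (k + 1) j g * A = A * extStdRep (k + 1) j g) :
    ∃ c : ℂ, A = c • 1 := by
  have hA' : ∀ g x, extStdRep (k + 1) j g (A x) = A (extStdRep (k + 1) j g x) :=
    fun g x => LinearMap.congr_fun (hA g) x
  have hdiag : ∀ s t, t ≠ s → (extBasis k j).repr (A (extBasis k j s)) t = 0 := by
    intro s t hts
    obtain ⟨i, his, hit⟩ := (Set.powersetCard.exists_mem_notMem_iff_ne s t).1 hts.symm
    have h := extBasis_repr_swap t i hit (A (extBasis k j s))
    rw [hA', extStdRep_swap_extBasis s i his, map_neg, map_neg, Finsupp.neg_apply] at h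
    exact self_eq_neg.1 h.symm
  refine eq_smul_of_diagonal (extBasis k j) A hdiag fun s t => ?_
  have hj : j ≤ k := by
    have := Finset.card_le_univ s.1
    rwa [Fintype.card_fin, show s.1.card = j from s.2] at this
  obtain ⟨g, hg⟩ := (MulAction.isMultiplyPretransitive_iff (G := Perm (Fin (k + 1)))
    (α := Fin (k + 1)) (n := j)).1
    (Perm.isMultiplyPretransitive (Fin (k + 1)) j)
    ((Set.powersetCard.ofFinEmbEquiv.symm s).toEmbedding.trans (Fin.succEmb k))
    ((Set.powersetCard.ofFinEmbEquiv.symm t).toEmbedding.trans (Fin.succEmb k))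
  have hg' : ∀ c, g⁻¹ (Set.powersetCard.ofFinEmbEquiv.symm t c).succ =
      (Set.powersetCard.ofFinEmbEquiv.symm s c).succ := by
    intro c
    rw [Perm.inv_eq_iff_eq]
    exact (DFunLike.congr_fun hg c).symm
  refine ⟨extStdRep (k + 1) j g, hA g, ?_⟩
  change (extBasis k j).repr (exteriorPower.map j (stdRep (k + 1) g) _) t = 1
  rw [extBasis_repr_map, ← Matrix.det_one (n := Fin j)]
  congr 1
  ext r c
  rw [Matrix.of_apply, stdBasis_coord, stdRep_apply, hg', stdBasis_apply_succ, Matrix.one_apply]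
  simp

/-! ### Characters of the exterior powers -/

/-- The characters of the exterior powers are the coefficients of the characteristic polynomial. -/
lemma chi_eq_coeff (hj : j ≤ k) (g : Perm (Fin (k + 1))) :
    chi (k + 1) j g = (-1) ^ j * (LinearMap.charpoly (stdRep (k + 1) g)).coeff (k - j) := by
  rw [← LinearMap.charpoly_toMatrix _ (stdBasis k)]
  have h := Matrix.charpoly_coeff_eq_sum_minors
    (LinearMap.toMatrix (stdBasis k) (stdBasis k) (stdRep (k + 1) g)) j (by simpa using hj)
  rw [Fintype.card_fin] at h
  rw [h, ← mul_assoc, ← mul_pow]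
  simp only [mul_neg, mul_one, neg_neg, one_pow, one_mul]
  have h1 : chi (k + 1) j g =
      LinearMap.trace ℂ _ (exteriorPower.map j (stdRep (k + 1) g)) := rfl
  rw [h1, LinearMap.trace_eq_matrix_trace ℂ (extBasis k j), Matrix.trace]
  symm
  refine Finset.sum_bij (fun s hs => (⟨s, (Finset.mem_powersetCard.1 hs).2⟩ :
    Set.powersetCard (Fin k) j)) (fun _ _ => Finset.mem_univ _) ?_ ?_ ?_
  · intro s hs t ht hst
    exact congrArg Subtype.val hst
  · intro s _
    exact ⟨s.1, Finset.mem_powersetCard.2 ⟨Finset.subset_univ _, s.2⟩, rfl⟩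
  · intro s hs
    have hs' : s.card = j := (Finset.mem_powersetCard.1 hs).2
    rw [Matrix.diag_apply, LinearMap.toMatrix_apply, extBasis_repr_map]
    rw [← Matrix.det_submatrix_equiv_self (s.orderIsoOfFin hs').toEquiv, ← Matrix.det_transpose]
    congr 1
    ext r c
    simp only [Matrix.transpose_apply, Matrix.submatrix_apply, LinearMap.toMatrix_apply,
      Matrix.of_apply]
    rfl

end Ext

section Characters

variable {k j : ℕ}

lemma isFullCycle_finRotate (k : ℕ) : IsFullCycle (finRotate (k + 1)) := by
  intro x y
  rcases Nat.eq_zero_or_pos k with rfl | hk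
  · rw [Subsingleton.elim (α := Fin 1) x y]
  · obtain ⟨k, rfl⟩ := Nat.exists_eq_succ_of_ne_zero hk.ne'
    have hs : ∀ x, finRotate (k + 1 + 1) x ≠ x := by
      intro x
      rw [← Perm.mem_support, support_finRotate]
      exact Finset.mem_univ _
    exact isCycle_finRotate.sameCycle (hs x) (hs y)

lemma finRotate_eigenvector {k : ℕ} {ω : ℂ} (hω : ω ^ (k + 1) = 1) (x : Fin (k + 1)) :
    ω ^ (finRotate (k + 1) x).val = ω * ω ^ x.val := by
  rw [← pow_succ']
  by_cases hx : x = Fin.last k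
  · subst hx
    rw [finRotate_last, Fin.val_last, hω]; simp
  · rw [coe_finRotate_of_ne_last hx]

/-- The eigenvalues of a full cycle on `W` are the nontrivial `n`-th roots of unity. -/
lemma charpoly_stdRep_of_isFullCycle {c : Perm (Fin (k + 1))} (hc : IsFullCycle c) :
    LinearMap.charpoly (stdRep (k + 1) c) = ∑ i ∈ Finset.range (k + 1), (X : ℂ[X]) ^ i := by
  have hconj : ∃ U : Perm (Fin (k + 1)), U * finRotate (k + 1) * U⁻¹ = c := by
    have h := card_conj_eq (isFullCycle_finRotate k) hc
    rw [Nat.card_fin] at h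
    have : Nonempty {U : Perm (Fin (k + 1)) // U * finRotate (k + 1) * U⁻¹ = c} :=
      (Nat.card_pos_iff.1 (h.symm.le.trans_lt' (Nat.succ_pos k))).1
    exact ⟨this.some.1, this.some.2⟩
  obtain ⟨U, hU⟩ := hconj
  have hroot : ∀ ω : ℂ, ω ^ (k + 1) = 1 → ω ≠ 1 →
      (LinearMap.charpoly (stdRep (k + 1) c)).IsRoot ω⁻¹ := by
    intro ω hω h1
    have hω0 : ω ≠ 0 := by rintro rfl; simp at hω
    rw [← Module.End.hasEigenvalue_iff_isRoot_charpoly]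
    have hsum : ∑ x : Fin (k + 1), ω ^ x.val = 0 := by
      rw [Fin.sum_univ_eq_sum_range (fun i => ω ^ i)]
      have h := geom_sum_mul ω (k + 1)
      rw [hω, sub_self, mul_eq_zero] at h
      exact h.resolve_right (sub_ne_zero.2 h1)
    let w : (stdSub (k + 1)).toSubmodule := ⟨fun x => ω ^ (U⁻¹ x).val, mem_stdSub.2
      ((Equiv.sum_comp U⁻¹ (fun x : Fin (k + 1) => ω ^ x.val)).trans hsum)⟩
    refine Module.End.hasEigenvalue_of_hasEigenvector (x := w) ⟨?_, ?_⟩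
    · rw [Module.End.mem_eigenspace_iff]
      ext x
      change ω ^ (U⁻¹ (c⁻¹ x)).val = ω⁻¹ * ω ^ (U⁻¹ x).val
      rw [eq_inv_mul_iff_mul_eq₀ hω0, ← finRotate_eigenvector hω]
      have h : finRotate (k + 1) (U⁻¹ (c⁻¹ x)) = U⁻¹ x := by
        rw [← hU]; simp
      rw [h]
    · intro h0
      have := congrArg (fun v : (stdSub (k + 1)).toSubmodule => v.1 (U 0)) h0
      simp [w] at this
  set P := LinearMap.charpoly (stdRep (k + 1) c) with hP
  have hPm : P.Monic := LinearMap.charpoly_monic _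
  have hPd : P.natDegree = k := by
    rw [hP, LinearMap.charpoly_natDegree, Module.finrank_eq_card_basis (stdBasis k),
      Fintype.card_fin]
  have hprim := Complex.isPrimitiveRoot_exp (k + 1) (Nat.succ_ne_zero k)
  have hdvd : (X ^ (k + 1) - 1 : ℂ[X]) ∣ P * (X - 1) := by
    rw [X_pow_sub_one_eq_prod (Nat.succ_pos k) hprim]
    refine Finset.prod_dvd_of_coprime ?_ fun ζ hζ => ?_
    · intro a _ b _ hab
      exact pairwise_coprime_X_sub_C Function.injective_id hab
    · rw [mem_nthRootsFinset (Nat.succ_pos k)] at hζ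
      rw [dvd_iff_isRoot]
      by_cases h1 : ζ = 1
      · simp [IsRoot, h1]
      · have h := hroot ζ⁻¹ (by rw [inv_pow, hζ, inv_one]) (by simpa using h1)
        rw [inv_inv] at h
        simp only [IsRoot, eval_mul] at h ⊢
        rw [h, zero_mul]
  have hm1 : (X - 1 : ℂ[X]).Monic := by simpa using monic_X_sub_C (1 : ℂ)
  have heq : P * (X - 1) = X ^ (k + 1) - 1 := by
    have hmon : (X ^ (k + 1) - 1 : ℂ[X]).Monic := by
      simpa using monic_X_pow_sub_C (1 : ℂ) (Nat.succ_ne_zero k)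
    refine eq_of_monic_of_dvd_of_natDegree_le hmon (hPm.mul hm1) hdvd ?_
    rw [hPm.natDegree_mul hm1, hPd]
    have h1 : (X - 1 : ℂ[X]).natDegree = 1 := by simpa using natDegree_X_sub_C (1 : ℂ)
    have h2 : (X ^ (k + 1) - 1 : ℂ[X]).natDegree = k + 1 := by
      simpa using natDegree_X_pow_sub_C (n := k + 1) (r := (1 : ℂ))
    rw [h1, h2]
  refine mul_right_cancel₀ hm1.ne_zero ?_
  rw [heq, geom_sum_mul]

lemma chi_of_isFullCycle {c : Perm (Fin (k + 1))} (hc : IsFullCycle c) (hj : j ≤ k) :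
    chi (k + 1) j c = (-1) ^ j := by
  rw [chi_eq_coeff hj, charpoly_stdRep_of_isFullCycle hc, finsetSum_coeff]
  simp [coeff_X_pow]

/-- The indicator function of the full cycles is a combination of the characters `χ_j`. -/
lemma sum_chi (g : Perm (Fin (k + 1))) [Decidable (IsFullCycle g)] :
    ∑ j ∈ Finset.range (k + 1), (-1) ^ j * chi (k + 1) j g =
      if IsFullCycle g then (k + 1 : ℂ) else 0 := by
  have h1 : ∑ j ∈ Finset.range (k + 1), (-1) ^ j * chi (k + 1) j g =
      (LinearMap.charpoly (stdRep (k + 1) g)).eval 1 := by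
    rw [eval_eq_sum_range, LinearMap.charpoly_natDegree,
      Module.finrank_eq_card_basis (stdBasis k), Fintype.card_fin, ← Finset.sum_range_reflect]
    refine Finset.sum_congr rfl fun j hj => ?_
    rw [Finset.mem_range, Nat.lt_succ_iff] at hj
    rw [chi_eq_coeff (by omega), ← mul_assoc, ← mul_pow]
    simp only [mul_neg, mul_one, neg_neg, one_pow, one_mul]
    congr 1
    omega
  rw [h1]
  split_ifs with hg
  · rw [charpoly_stdRep_of_isFullCycle hg, eval_finsetSum]
    simp
  · -- the orbit of a point and its complement yield a fixed vector of `g` in `W`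
    have hg' : ∃ x y, ¬ g.SameCycle x y := by
      by_contra! h
      exact hg h
    obtain ⟨x, y, hxy⟩ := hg'
    classical
    let O : Finset (Fin (k + 1)) := Finset.univ.filter fun z => g.SameCycle x z
    have hO : ∀ z, g⁻¹ z ∈ O ↔ z ∈ O := by
      intro z
      simp [O]
    have hx : x ∈ O := by simp [O, Perm.SameCycle.refl]
    have hy : y ∉ O := by simp [O, hxy]
    let w : (stdSub (k + 1)).toSubmodule :=
      ⟨fun z => if z ∈ O then (Oᶜ.card : ℂ) else -O.card, mem_stdSub.2 (by
        rw [Finset.sum_ite, Finset.sum_const, Finset.sum_const, Finset.filter_mem_eq_inter,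
          Finset.univ_inter, nsmul_eq_mul, nsmul_eq_mul,
          show Finset.univ.filter (fun z => z ∉ O) = Oᶜ by ext; simp]
        ring)⟩
    change (LinearMap.charpoly (stdRep (k + 1) g)).IsRoot 1
    rw [← Module.End.hasEigenvalue_iff_isRoot_charpoly]
    refine Module.End.hasEigenvalue_of_hasEigenvector (x := w) ⟨?_, ?_⟩
    · rw [Module.End.mem_eigenspace_iff, one_smul]
      ext z
      rw [stdRep_apply]
      simp only [w, hO]
    · intro h0
      have := congrArg (fun v : (stdSub (k + 1)).toSubmodule => v.1 y) h0
      simp only [w, hy, if_false] at this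
      have h2 : O.card = 0 := by
        have h3 : -(O.card : ℂ) = 0 := this
        exact_mod_cast neg_eq_zero.1 h3
      exact absurd hx (by simp [Finset.card_eq_zero.1 h2])

/-- The sum of all full cycles acts on the irreducible representation `∧^j W` as a scalar, which
is found by taking the trace. -/
lemma sum_chi_mul [DecidablePred (IsFullCycle (X := Fin (k + 1)))] (hj : j ≤ k)
    (ν : Perm (Fin (k + 1))) :
    ∑ ρ with IsFullCycle ρ, chi (k + 1) j (ν * ρ) =
      (-1) ^ j * (j.factorial * (k - j).factorial : ℂ) * chi (k + 1) j ν := by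
  set K : Module.End ℂ (⋀[ℂ]^j (stdSub (k + 1)).toSubmodule) :=
    ∑ ρ with IsFullCycle ρ, extStdRep (k + 1) j ρ with hK
  have hcomm : ∀ g, extStdRep (k + 1) j g * K = K * extStdRep (k + 1) j g := by
    intro g
    rw [hK, Finset.mul_sum, Finset.sum_mul]
    refine Finset.sum_equiv (MulAut.conj g).toEquiv ?_ ?_
    · intro ρ
      simp only [Finset.mem_filter, Finset.mem_univ, true_and]
      exact (isFullCycle_permCongr g ρ).symm
    · intro ρ _
      rw [← map_mul, ← map_mul]
      congr 1
      simp
  obtain ⟨c, hc⟩ := eq_smul_of_commute K hcomm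
  have htr : ∀ ν, ∑ ρ with IsFullCycle ρ, chi (k + 1) j (ν * ρ) = c * chi (k + 1) j ν := by
    intro ν
    have h : LinearMap.trace ℂ _ (extStdRep (k + 1) j ν * K) = c * chi (k + 1) j ν := by
      rw [hc, mul_smul_comm, mul_one, map_smul]
      rfl
    rw [← h, hK, Finset.mul_sum, map_sum]
    refine Finset.sum_congr rfl fun ρ _ => ?_
    rw [← map_mul]
    rfl
  have hcard : (Finset.univ.filter fun ρ : Perm (Fin (k + 1)) => IsFullCycle ρ).card =
      k.factorial := by
    have h := card_isFullCycle (X := Fin (k + 1))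
    rw [Nat.card_eq_fintype_card, Fintype.card_subtype, Nat.card_fin] at h
    simpa using h
  have hone : chi (k + 1) j 1 = (k.choose j : ℂ) := by
    unfold chi
    rw [Representation.char_one, exteriorPower.finrank_eq,
      Module.finrank_eq_card_basis (stdBasis k), Fintype.card_fin]
  have h1 := htr 1
  rw [hone, Finset.sum_congr rfl (g := fun _ => (-1 : ℂ) ^ j) (fun ρ hρ => by
    rw [one_mul]
    exact chi_of_isFullCycle (Finset.mem_filter.1 hρ).2 hj), Finset.sum_const, hcard,
    nsmul_eq_mul] at h1
  rw [htr]
  congr 1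
  have hch : (k.choose j : ℂ) ≠ 0 := by exact_mod_cast (Nat.choose_pos hj).ne'
  refine mul_right_cancel₀ hch ?_
  rw [← h1, ← Nat.choose_mul_factorial_mul_factorial hj]
  push_cast
  ring

/-- **Frobenius' formula** for the number of factorizations of `ν` into two full cycles. -/
theorem numFull_eq {n : ℕ} (hn : 1 ≤ n) (ν : Perm (Fin n)) :
    (n : ℂ) * numFull ν =
      ∑ j ∈ Finset.range n, (j.factorial : ℂ) * ((n - 1 - j).factorial : ℂ) * chi n j ν := by
  classical
  obtain ⟨k, rfl⟩ := Nat.exists_eq_add_of_le' hn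
  have h1 : ((k + 1 : ℕ) : ℂ) * numFull ν =
      ∑ ρ : Perm (Fin (k + 1)) with IsFullCycle ρ,
        if IsFullCycle (ν * ρ) then (k + 1 : ℂ) else 0 := by
    rw [numFull, Nat.card_eq_fintype_card, Fintype.card_subtype, ← Finset.filter_filter,
      ← Finset.sum_filter, Finset.sum_const, nsmul_eq_mul]
    push_cast
    ring
  simp_rw [← sum_chi] at h1
  rw [h1, Finset.sum_comm]
  refine Finset.sum_congr rfl fun j hj => ?_
  have hj' : j ≤ k := Nat.lt_succ_iff.1 (Finset.mem_range.1 hj)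
  rw [← Finset.mul_sum, sum_chi_mul hj', ← mul_assoc, ← mul_assoc, ← mul_pow]
  simp

end Characters

end StandardRepresentation

/-! ### Square-tiled surfaces on arbitrary sets of squares -/

/-- The gluing data of a surface tiled by squares that are numbered by `X`. The `i`-th zero is
given by the set `zeros i` of the squares that have it as their bottom-left corner. -/
@[ext]
structure SquareData (r : ℕ) (X : Type) where
  /-- The right neighbour of a square. -/
  right : Perm X
  /-- The top neighbour of a square. -/
  up : Perm X
  /-- The bottom-left corners at the numbered zeros. -/
  zeros : Fin r → Set X

namespace SquareData

variable {r : ℕ} {X Y Z : Type}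

/-- The turn by `2π` around the bottom-left corner of a square. -/
def turn (D : SquareData r X) : Perm X := D.up * D.right * D.up⁻¹ * D.right⁻¹

/-- The conditions on gluing data that define a `Surface` in the stratum of `m`. -/
structure IsSurface (m : Fin r → ℕ) (D : SquareData r X) : Prop where
  connected : MulAction.IsPretransitive (Subgroup.closure {D.right, D.up}) X
  zeros_eq : ∀ i, ∃ s, D.zeros i = {t | D.turn.SameCycle s t}
  injective : Function.Injective D.zeros
  ncard_zeros : ∀ i, (D.zeros i).ncard = m i + 1
  turn_eq : ∀ s, (∀ i, s ∉ D.zeros i) → D.turn s = s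

/-- Renumbering the squares. -/
def map (e : X ≃ Y) (D : SquareData r X) : SquareData r Y where
  right := e.permCongr D.right
  up := e.permCongr D.up
  zeros i := e '' D.zeros i

lemma map_map (D : SquareData r X) (e : X ≃ Y) (f : Y ≃ Z) :
    (D.map e).map f = D.map (e.trans f) := by
  ext
  · rfl
  · rfl
  · simp only [map, Set.image_image, coe_trans, Function.comp_apply]

@[simp] lemma map_refl (D : SquareData r X) : D.map (Equiv.refl X) = D := by
  ext
  · rfl
  · rfl
  · simp [map]

lemma turn_map (D : SquareData r X) (e : X ≃ Y) : (D.map e).turn = e.permCongr D.turn := by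
  simp [turn, map, permCongr_inv']

lemma isPretransitive_of {G : Type*} [Group G] [MulAction G X]
    (h : ∀ f : X → Prop, (∀ (g : G) x, f (g • x) ↔ f x) → ∀ x y, f x → f y) :
    MulAction.IsPretransitive G X := by
  refine ⟨fun x y => ?_⟩
  refine h (fun z => ∃ g : G, g • x = z) (fun g z => ⟨?_, ?_⟩) x y ⟨1, one_smul _ _⟩
  · rintro ⟨g', h'⟩
    exact ⟨g⁻¹ * g', by rw [mul_smul, h', inv_smul_smul]⟩
  · rintro ⟨g', rfl⟩
    exact ⟨g * g', mul_smul _ _ _⟩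

lemma eq_of_isPretransitive {R U : Perm X}
    (h : MulAction.IsPretransitive (Subgroup.closure {R, U}) X) {f : X → Prop}
    (hR : ∀ x, f (R x) ↔ f x) (hU : ∀ x, f (U x) ↔ f x) (x y : X) (hx : f x) : f y := by
  obtain ⟨⟨g, hg⟩, rfl⟩ := h.exists_smul_eq x y
  have key : ∀ z, f (g z) ↔ f z := by
    induction hg using Subgroup.closure_induction with
    | mem g hg =>
      rcases hg with rfl | rfl
      · exact hR
      · exact hU
    | one => simp
    | mul a b _ _ ha hb => intro z; rw [Perm.mul_apply, ha, hb]
    | inv a _ ha => intro z; rw [← ha (a⁻¹ z), ← Perm.mul_apply, mul_inv_cancel, Perm.one_apply]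
  exact (key x).2 hx

/-- Connectedness: a set of squares that is closed under passing to neighbours is
everything or empty. -/
lemma isPretransitive_iff {R U : Perm X} :
    MulAction.IsPretransitive (Subgroup.closure {R, U}) X ↔
      ∀ f : X → Prop, (∀ x, f (R x) ↔ f x) → (∀ x, f (U x) ↔ f x) → ∀ x y, f x → f y := by
  constructor
  · intro h f hR hU
    exact eq_of_isPretransitive h hR hU
  · intro h
    refine isPretransitive_of fun f hf => h f (fun x => ?_) (fun x => ?_)
    · exact hf ⟨R, Subgroup.subset_closure (by simp)⟩ x
    · exact hf ⟨U, Subgroup.subset_closure (by simp)⟩ x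

lemma IsSurface.map {m : Fin r → ℕ} {D : SquareData r X} (hD : D.IsSurface m) (e : X ≃ Y) :
    (D.map e).IsSurface m where
  connected := by
    rw [isPretransitive_iff]
    intro f hR hU x y hx
    have := isPretransitive_iff.1 hD.connected (fun z => f (e z))
      (fun z => by simpa [SquareData.map] using hR (e z))
      (fun z => by simpa [SquareData.map] using hU (e z)) (e.symm x) (e.symm y)
    simpa [hx] using this
  zeros_eq i := by
    obtain ⟨s, hs⟩ := hD.zeros_eq i
    refine ⟨e s, ?_⟩
    ext t
    obtain ⟨t, rfl⟩ := e.surjective t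
    rw [turn_map]
    simp only [SquareData.map, hs, Set.mem_ofPred_eq, sameCycle_permCongr]
    rw [e.injective.mem_set_image]
    rfl
  injective := e.injective.image_injective.comp hD.injective
  ncard_zeros i := by
    rw [← hD.ncard_zeros i]
    exact Set.ncard_image_of_injective _ e.injective
  turn_eq s hs := by
    obtain ⟨s, rfl⟩ := e.surjective s
    rw [turn_map]
    simp only [permCongr_apply, symm_apply_apply, EmbeddingLike.apply_eq_iff_eq]
    refine hD.turn_eq s fun i hi => hs i (Set.mem_image_of_mem e hi)

/-- The squares whose row has a zero on its bottom side. -/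
def critical (D : SquareData r X) : Set X :=
  {s | ∃ (k : ℤ) (i : Fin r), (D.right ^ k) s ∈ D.zeros i}

lemma critical_map (D : SquareData r X) (e : X ≃ Y) : (D.map e).critical = e '' D.critical := by
  ext s
  obtain ⟨s, rfl⟩ := e.surjective s
  rw [e.injective.mem_set_image]
  simp [critical, map, permCongr_zpow]

lemma zpow_mem_critical (D : SquareData r X) (k : ℤ) (s : X) :
    (D.right ^ k) s ∈ D.critical ↔ s ∈ D.critical := by
  constructor
  · rintro ⟨j, i, h⟩
    exact ⟨j + k, i, by rwa [zpow_add]⟩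
  · rintro ⟨j, i, h⟩
    refine ⟨j - k, i, ?_⟩
    rwa [← Perm.mul_apply, ← zpow_add, sub_add_cancel]

/-- There is at most one cylinder: a set of squares that is a union of cylinders
is everything or empty. -/
def OneCylinder (D : SquareData r X) : Prop :=
  ∀ f : X → Prop, (∀ s, f (D.right s) ↔ f s) → (∀ s, D.up s ∉ D.critical → (f (D.up s) ↔ f s)) →
    ∀ s t, f s → f t

lemma OneCylinder.map {D : SquareData r X} (hD : D.OneCylinder) (e : X ≃ Y) :
    (D.map e).OneCylinder := by
  intro f hR hU x y hx
  rw [critical_map] at hU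
  have := hD (fun z => f (e z))
    (fun z => by simpa [SquareData.map] using hR (e z))
    (fun z hz => by
      have h := hU (e z)
      simp only [SquareData.map, permCongr_apply, symm_apply_apply,
        e.injective.mem_set_image] at h
      exact h hz) (e.symm x) (e.symm y)
  simpa [hx] using this

end SquareData

namespace Surface

variable {r : ℕ} {m : Fin r → ℕ} {M : ℕ}

/-- The gluing data of a surface. -/
def toData (S : Surface m M) : SquareData r (Fin M) where
  right := S.right
  up := S.up
  zeros i := {s | (⟦s⟧ : Vertex S.right S.up) = S.zero i}

lemma mk_eq_mk (S : Surface m M) (s t : Fin M) :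
    (⟦s⟧ : Vertex S.right S.up) = ⟦t⟧ ↔ S.toData.turn.SameCycle s t :=
  Quotient.eq

lemma isSurface_toData (S : Surface m M) : S.toData.IsSurface m where
  connected := S.connected
  zeros_eq i := by
    obtain ⟨s, hs⟩ := Quotient.exists_rep (S.zero i)
    refine ⟨s, ?_⟩
    ext t
    rw [Set.mem_ofPred_eq, ← mk_eq_mk, hs]
    exact eq_comm
  injective i j hij := by
    obtain ⟨s, hs⟩ := Quotient.exists_rep (S.zero i)
    have h : s ∈ S.toData.zeros j := by
      rw [← hij]
      exact hs
    exact S.zero_injective (hs.symm.trans h)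
  ncard_zeros i := by
    rw [← S.multiplicity_zero i]
    exact Nat.card_coe_set_eq _
  turn_eq s hs := by
    have h := S.multiplicity_other ⟦s⟧ (by rintro ⟨i, hi⟩; exact hs i hi.symm)
    rw [multiplicity, Nat.card_eq_one_iff_unique] at h
    have h1 := h.1.elim ⟨S.toData.turn s, (mk_eq_mk S _ _).2
      (Perm.sameCycle_apply_left.2 (Perm.SameCycle.refl _ _))⟩ ⟨s, rfl⟩
    exact congrArg Subtype.val h1

/-- Gluing data that satisfy `IsSurface` come from a surface. -/
lemma exists_toData_eq {D : SquareData r (Fin M)} (hD : D.IsSurface m) :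
    ∃ S : Surface m M, S.toData = D := by
  choose z hz using hD.zeros_eq
  have hmem : ∀ s i, (⟦s⟧ : Vertex D.right D.up) = ⟦z i⟧ ↔ s ∈ D.zeros i := by
    intro s i
    rw [hz, Set.mem_ofPred_eq, eq_comm]
    exact Quotient.eq
  refine ⟨{ right := D.right, up := D.up, connected := hD.connected, zero := fun i => ⟦z i⟧,
            zero_injective := ?_, multiplicity_zero := ?_, multiplicity_other := ?_ }, ?_⟩
  · intro i j hij
    apply hD.injective
    ext s
    rw [← hmem, ← hmem, show (⟦z i⟧ : Vertex D.right D.up) = ⟦z j⟧ from hij]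
  · intro i
    rw [← hD.ncard_zeros i, multiplicity, ← Nat.card_coe_set_eq]
    exact Nat.card_congr (Equiv.subtypeEquivRight fun s => hmem s i)
  · intro p hp
    obtain ⟨s, rfl⟩ := Quotient.exists_rep p
    have hs : D.turn s = s := hD.turn_eq s fun i hi => hp ⟨i, ((hmem s i).2 hi).symm⟩
    rw [multiplicity, Nat.card_eq_one_iff_unique]
    refine ⟨⟨?_⟩, ⟨⟨s, rfl⟩⟩⟩
    have key : ∀ t : Fin M, (⟦t⟧ : Vertex D.right D.up) = ⟦s⟧ → t = s := by
      intro t ht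
      have h : D.turn.SameCycle s t := Quotient.eq.1 ht.symm
      obtain ⟨k, rfl⟩ := h
      exact Perm.zpow_apply_eq_self_of_apply_eq_self hs k
    rintro ⟨t, ht⟩ ⟨u, hu⟩
    exact Subtype.ext ((key t ht).trans (key u hu).symm)
  · ext
    · rfl
    · rfl
    · exact hmem _ _

lemma isIso_iff (S T : Surface m M) (f : Perm (Fin M)) :
    S.IsIso T f ↔ S.toData.map f = T.toData := by
  have hperm : ∀ R R' : Perm (Fin M), (∀ s, f (R s) = R' (f s)) ↔ f.permCongr R = R' := by
    intro R R'
    constructor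
    · intro h
      ext s
      rw [permCongr_apply, h, apply_symm_apply]
    · rintro rfl s
      simp
  have hz : (∀ i s, (⟦s⟧ : Vertex S.right S.up) = S.zero i ↔
      (⟦f s⟧ : Vertex T.right T.up) = T.zero i) ↔
      (fun i => f '' S.toData.zeros i) = T.toData.zeros := by
    constructor
    · intro h
      ext i s
      obtain ⟨s, rfl⟩ := f.surjective s
      rw [f.injective.mem_set_image]
      exact h i s
    · intro h i s
      change s ∈ S.toData.zeros i ↔ f s ∈ T.toData.zeros i
      rw [← h, f.injective.mem_set_image]
  rw [IsIso, hperm, hperm, hz, SquareData.ext_iff]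
  rfl

lemma equiv_iff (S T : Surface m M) :
    S ≈ T ↔ ∃ f : Perm (Fin M), S.toData.map f = T.toData :=
  exists_congr fun f => isIso_iff S T f

lemma numCylinders_eq_one_iff (hM : M ≠ 0) (S : Surface m M) :
    S.numCylinders = 1 ↔ S.toData.OneCylinder := by
  have : Nonempty S.Cylinder := ⟨Quot.mk _ ⟨0, Nat.pos_of_ne_zero hM⟩⟩
  rw [numCylinders, Nat.card_eq_one_iff_unique, and_iff_left this]
  constructor
  · intro h f hR hU s t hs
    have hst : (Quot.mk _ s : S.Cylinder) = Quot.mk _ t := h.elim _ _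
    have key : Quot.lift f (by
      rintro s t (rfl | ⟨rfl, ht⟩)
      · exact propext (hR s).symm
      · exact propext (hU s ht).symm) (Quot.mk _ s : S.Cylinder) := hs
    rw [hst] at key
    exact key
  · intro h
    refine ⟨fun p q => ?_⟩
    obtain ⟨s, rfl⟩ := Quot.exists_rep p
    obtain ⟨t, rfl⟩ := Quot.exists_rep q
    refine h (fun t => (Quot.mk _ s : S.Cylinder) = Quot.mk _ t) (fun t => ?_) (fun t ht => ?_)
      s t rfl
    · have : (Quot.mk _ t : S.Cylinder) = Quot.mk _ (S.right t) := Quot.sound (Or.inl rfl)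
      change _ = Quot.mk _ (S.right t) ↔ _
      rw [← this]
    · have : (Quot.mk _ t : S.Cylinder) = Quot.mk _ (S.up t) := Quot.sound (Or.inr ⟨rfl, ht⟩)
      change _ = Quot.mk _ (S.up t) ↔ _
      rw [← this]

end Surface

namespace SquareData

variable {r : ℕ} {X C C' : Type}

/-! ### Cylinders over surfaces with a single row -/

/-- The surface obtained from a surface with a single row by increasing the height of the row from
`1` to `k + 1`. The zeros stay in the bottom row. -/
def suspend (k : ℕ) (D : SquareData r C) : SquareData r (Fin (k + 1) × C) where
  right := Equiv.prodCongr (Equiv.refl _) D.right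
  up := Perm.prodExtendRight 0 D.up * Equiv.prodCongr (finRotate (k + 1)) (Equiv.refl _)
  zeros i := {p | p.1 = 0 ∧ p.2 ∈ D.zeros i}

section Suspend

variable (k : ℕ) (D : SquareData r C)

lemma suspend_right_apply (p : Fin (k + 1) × C) : (D.suspend k).right p = (p.1, D.right p.2) := rfl

lemma suspend_right_zpow (j : ℤ) (p : Fin (k + 1) × C) :
    ((D.suspend k).right ^ j) p = (p.1, (D.right ^ j) p.2) := by
  have hinv : ∀ p, (D.suspend k).right⁻¹ p = (p.1, D.right⁻¹ p.2) := by
    intro p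
    rw [Perm.inv_eq_iff_eq, suspend_right_apply]
    simp
  induction j using Int.induction_on generalizing p with
  | zero => simp
  | succ i ih => simp only [zpow_add, zpow_one, Perm.mul_apply, ih, suspend_right_apply]
  | pred i ih => simp only [zpow_sub, zpow_one, Perm.mul_apply, ih, hinv]

lemma suspend_up_castSucc (y : Fin k) (c : C) :
    (D.suspend k).up (y.castSucc, c) = (y.succ, c) := by
  have h : (D.suspend k).up (y.castSucc, c) =
      Perm.prodExtendRight 0 D.up (finRotate (k + 1) y.castSucc, c) := rfl
  have hy : finRotate (k + 1) y.castSucc = y.succ := by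
    apply Fin.ext
    rw [coe_finRotate_of_ne_last (Fin.castSucc_lt_last y).ne]
    simp
  rw [h, hy, Perm.prodExtendRight_apply_ne _ (Fin.succ_ne_zero y)]

lemma suspend_up_last (c : C) : (D.suspend k).up (Fin.last k, c) = (0, D.up c) := by
  have h : (D.suspend k).up (Fin.last k, c) =
      Perm.prodExtendRight 0 D.up (finRotate (k + 1) (Fin.last k), c) := rfl
  rw [h, finRotate_last, Perm.prodExtendRight_apply_eq]

lemma suspend_turn : (D.suspend k).turn = Perm.prodExtendRight 0 D.turn := by
  rw [turn, mul_inv_eq_iff_eq_mul, mul_inv_eq_iff_eq_mul]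
  ext1 ⟨y, c⟩
  simp only [Perm.mul_apply]
  refine Fin.lastCases ?_ (fun y => ?_) y
  · rw [suspend_up_last, suspend_right_apply, suspend_right_apply, suspend_up_last]
    simp only
    rw [Perm.prodExtendRight_apply_eq]
    simp [turn]
  · rw [suspend_up_castSucc, suspend_right_apply, suspend_right_apply, suspend_up_castSucc]
    simp only
    rw [Perm.prodExtendRight_apply_ne _ (Fin.succ_ne_zero y)]

lemma suspend_turn_zero (c : C) : (D.suspend k).turn (0, c) = (0, D.turn c) := by
  rw [suspend_turn, Perm.prodExtendRight_apply_eq]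

lemma suspend_sameCycle (c : C) (p : Fin (k + 1) × C) :
    (D.suspend k).turn.SameCycle (0, c) p ↔ p.1 = 0 ∧ D.turn.SameCycle c p.2 := by
  have hinv : ∀ c, (D.suspend k).turn⁻¹ (0, c) = (0, D.turn⁻¹ c) := by
    intro c
    rw [Perm.inv_eq_iff_eq, suspend_turn_zero]
    simp
  have hz : ∀ (j : ℤ) c, ((D.suspend k).turn ^ j) (0, c) = (0, (D.turn ^ j) c) := by
    intro j
    induction j using Int.induction_on with
    | zero => simp
    | succ i ih => intro c; simp only [zpow_add, zpow_one, Perm.mul_apply, ih, suspend_turn_zero]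
    | pred i ih => intro c; simp only [zpow_sub, zpow_one, Perm.mul_apply, ih, hinv]
  obtain ⟨y, d⟩ := p
  simp only [Perm.SameCycle, hz, Prod.mk.injEq]
  constructor
  · rintro ⟨j, h1, h2⟩
    exact ⟨h1.symm, j, h2⟩
  · rintro ⟨h1, j, h2⟩
    exact ⟨j, h1.symm, h2⟩

lemma suspend_zeros (i : Fin r) : (D.suspend k).zeros i = Prod.mk 0 '' D.zeros i := by
  ext ⟨y, c⟩
  simp only [suspend, Set.mem_ofPred_eq, Set.mem_image, Prod.mk.injEq]
  constructor
  · rintro ⟨rfl, h⟩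
    exact ⟨c, h, rfl, rfl⟩
  · rintro ⟨d, h, rfl, rfl⟩
    exact ⟨rfl, h⟩

variable {k D}

lemma isFullCycle_isPretransitive (hR : IsFullCycle D.right) :
    MulAction.IsPretransitive (Subgroup.closure {D.right, D.up}) C := by
  rw [isPretransitive_iff]
  intro f h _ x y hx
  exact (hR.eq_of_invariant f (fun z => propext (h z)) x y) ▸ hx

lemma critical_of_isFullCycle (hR : IsFullCycle D.right) (hne : ∃ i, (D.zeros i).Nonempty) :
    D.critical = Set.univ := by
  obtain ⟨i, t, ht⟩ := hne
  refine Set.eq_univ_of_forall fun s => ?_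
  obtain ⟨j, rfl⟩ := hR s t
  exact ⟨j, i, ht⟩

lemma suspend_critical (hR : IsFullCycle D.right) (hne : ∃ i, (D.zeros i).Nonempty) :
    (D.suspend k).critical = Set.range (Prod.mk 0) := by
  ext ⟨y, c⟩
  simp only [critical, suspend_right_zpow, Set.mem_ofPred_eq, Set.mem_range, Prod.mk.injEq]
  constructor
  · rintro ⟨j, i, h1, h2⟩
    exact ⟨c, Eq.symm h1, rfl⟩
  · rintro ⟨d, rfl, rfl⟩
    obtain ⟨j, i, h⟩ : d ∈ D.critical := by
      rw [critical_of_isFullCycle hR hne]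
      trivial
    exact ⟨j, i, rfl, h⟩

/-- A set of squares that is closed under horizontal neighbours and under vertical
neighbours inside the cylinder is everything or empty. -/
lemma suspend_induction (hR : IsFullCycle D.right) {f : Fin (k + 1) × C → Prop}
    (h1 : ∀ s, f ((D.suspend k).right s) ↔ f s)
    (h2 : ∀ (y : Fin k) c, f (y.succ, c) ↔ f (y.castSucc, c)) (s t : Fin (k + 1) × C) (hs : f s) :
    f t := by
  have h0 : ∀ (y : Fin (k + 1)) c, f (y, c) ↔ f (0, c) := by
    intro y
    induction y using Fin.induction with
    | zero => exact fun c => Iff.rfl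
    | succ y ih => exact fun c => (h2 y c).trans (ih c)
  have h3 := hR.eq_of_invariant (fun c => f (0, c)) (fun c => propext (h1 (0, c))) s.2 t.2
  rw [show t = (t.1, t.2) from rfl, h0, ← h3, ← h0 s.1]
  exact hs

lemma suspend_oneCylinder (hR : IsFullCycle D.right) (hne : ∃ i, (D.zeros i).Nonempty) :
    (D.suspend k).OneCylinder := by
  intro f h1 h2
  refine suspend_induction hR h1 fun y c => ?_
  rw [← suspend_up_castSucc k D]
  refine h2 _ ?_
  rw [suspend_critical hR hne, suspend_up_castSucc]
  rintro ⟨d, hd⟩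
  exact Fin.succ_ne_zero y (congrArg Prod.fst hd).symm

lemma suspend_isSurface_iff {m : Fin r → ℕ} (hR : IsFullCycle D.right) :
    (D.suspend k).IsSurface m ↔ D.IsSurface m := by
  have hinj : Function.Injective (Prod.mk (0 : Fin (k + 1)) : C → _) := Prod.mk_right_injective 0
  have hz : ∀ i s, (D.suspend k).zeros i = {t | (D.suspend k).turn.SameCycle (0, s) t} ↔
      D.zeros i = {t | D.turn.SameCycle s t} := by
    intro i s
    have : {t | (D.suspend k).turn.SameCycle (0, s) t} =
        Prod.mk 0 '' {t | D.turn.SameCycle s t} := by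
      ext ⟨y, c⟩
      simp only [Set.mem_ofPred_eq, suspend_sameCycle, Set.mem_image, Prod.mk.injEq]
      constructor
      · rintro ⟨rfl, h⟩
        exact ⟨c, h, rfl, rfl⟩
      · rintro ⟨d, h, rfl, rfl⟩
        exact ⟨rfl, h⟩
    rw [this, suspend_zeros, hinj.image_injective.eq_iff]
  constructor
  · intro h
    refine ⟨isFullCycle_isPretransitive hR, fun i => ?_, fun i j hij => ?_, fun i => ?_,
      fun s hs => ?_⟩
    · obtain ⟨⟨y, s⟩, hs⟩ := h.zeros_eq i
      have hmem : (y, s) ∈ (D.suspend k).zeros i := by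
        rw [hs]
        exact Perm.SameCycle.refl _ _
      obtain rfl : y = 0 := hmem.1
      exact ⟨s, (hz i s).1 hs⟩
    · apply h.injective
      rw [suspend_zeros, suspend_zeros, hij]
    · rw [← h.ncard_zeros, suspend_zeros, Set.ncard_image_of_injective _ hinj]
    · have := h.turn_eq (0, s) fun i hi => hs i hi.2
      rw [suspend_turn_zero] at this
      exact (Prod.mk.injEq _ _ _ _ ▸ this).2
  · intro h
    refine ⟨?_, fun i => ?_, fun i j hij => ?_, fun i => ?_, ?_⟩
    · rw [isPretransitive_iff]
      intro f h1 h2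
      refine suspend_induction hR h1 fun y c => ?_
      rw [← suspend_up_castSucc k D, h2]
    · obtain ⟨s, hs⟩ := h.zeros_eq i
      exact ⟨(0, s), (hz i s).2 hs⟩
    · apply h.injective
      rw [suspend_zeros, suspend_zeros] at hij
      exact hinj.image_injective hij
    · rw [← h.ncard_zeros, suspend_zeros, Set.ncard_image_of_injective _ hinj]
    · rintro ⟨y, s⟩ hs
      by_cases hy : y = 0
      · subst hy
        rw [suspend_turn_zero, h.turn_eq s fun i hi => hs i ⟨rfl, hi⟩]
      · rw [suspend_turn, Perm.prodExtendRight_apply_ne _ hy]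

lemma suspend_map (D : SquareData r C) (f : C ≃ C') :
    (D.map f).suspend k = (D.suspend k).map (Equiv.prodCongr (Equiv.refl _) f) := by
  ext1
  · rfl
  · apply Equiv.ext
    rintro ⟨y, c⟩
    obtain ⟨c, rfl⟩ := f.surjective c
    rw [show (y, f c) = Equiv.prodCongr (Equiv.refl _) f (y, c) from rfl]
    simp only [map, permCongr_apply, symm_apply_apply]
    refine Fin.lastCases ?_ (fun y => ?_) y
    · rw [suspend_up_last]
      change (suspend k (D.map f)).up (Fin.last k, f c) = _
      rw [suspend_up_last]
      simp [map]
    · rw [suspend_up_castSucc]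
      change (suspend k (D.map f)).up (y.castSucc, f c) = _
      rw [suspend_up_castSucc]
      rfl
  · ext i ⟨y, c⟩
    obtain ⟨c, rfl⟩ := f.surjective c
    rw [show (y, f c) = Equiv.prodCongr (Equiv.refl _) f (y, c) from rfl]
    simp only [map, (Equiv.injective _).mem_set_image]
    simp [suspend]

/-- An isomorphism of surfaces with one cylinder restricts to the bottom rows. -/
lemma exists_of_map_suspend_eq {D' : SquareData r C'} {k' : ℕ} (hR : IsFullCycle D.right)
    (hne : ∃ i, (D.zeros i).Nonempty) (hR' : IsFullCycle D'.right)
    (hne' : ∃ i, (D'.zeros i).Nonempty) (φ : Fin (k + 1) × C ≃ Fin (k' + 1) × C')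
    (h : (D.suspend k).map φ = D'.suspend k') : ∃ f : C ≃ C', ∀ c, φ (0, c) = (0, f c) := by
  have hc : φ '' (Set.range (Prod.mk 0)) = Set.range (Prod.mk 0) := by
    rw [← suspend_critical hR hne, ← critical_map, h, suspend_critical hR' hne']
  have h1 : ∀ c, ∃ d, φ (0, c) = (0, d) := by
    intro c
    obtain ⟨d, hd⟩ := hc.subset ⟨_, ⟨c, rfl⟩, rfl⟩
    exact ⟨d, hd.symm⟩
  choose f hf using h1
  refine ⟨Equiv.ofBijective f ⟨fun a b hab => ?_, fun d => ?_⟩, hf⟩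
  · have : φ (0, a) = φ (0, b) := by rw [hf, hf, hab]
    exact (Prod.mk.injEq _ _ _ _ ▸ φ.injective this).2
  · obtain ⟨_, ⟨c, rfl⟩, h2⟩ := hc.symm.subset ⟨d, rfl⟩
    refine ⟨c, ?_⟩
    rw [hf] at h2
    exact (Prod.mk.injEq _ _ _ _ ▸ h2).2

lemma suspend_up_pow (c : C) : ((D.suspend k).up ^ (k + 1)) (0, c) = (0, D.up c) := by
  have h : ∀ y : Fin (k + 1), ((D.suspend k).up ^ y.val) (0, c) = (y, c) := by
    intro y
    induction y using Fin.induction with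
    | zero => rfl
    | succ y ih =>
      rw [Fin.val_succ, pow_succ', Perm.mul_apply]
      rw [Fin.val_castSucc] at ih
      rw [ih, suspend_up_castSucc]
  rw [pow_succ', Perm.mul_apply]
  have := h (Fin.last k)
  rw [Fin.val_last] at this
  rw [this, suspend_up_last]

lemma permCongr_pow' (e : X ≃ C) (σ : Perm X) (j : ℕ) :
    (e.permCongr σ) ^ j = e.permCongr (σ ^ j) :=
  (map_pow e.permCongrHom σ j).symm

/-- The restriction of an isomorphism to the bottom rows is an isomorphism of the surfaces with a
single row; the gluing `D.up` is recovered as the `k + 1`-st power of the vertical step. -/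
lemma map_eq_of_map_suspend_eq {D' : SquareData r C'} (f : C ≃ C')
    (φ : Fin (k + 1) × C ≃ Fin (k + 1) × C')
    (h : (D.suspend k).map φ = D'.suspend k) (hf : ∀ c, φ (0, c) = (0, f c)) :
    D.map f = D' := by
  have hf' : ∀ c, φ.symm (0, c) = (0, f.symm c) := by
    intro c
    rw [Equiv.symm_apply_eq, hf, apply_symm_apply]
  have hR := congrArg SquareData.right h
  have hU := congrArg SquareData.up h
  have hZ := congrArg SquareData.zeros h
  ext1
  · ext c
    have h1 := Equiv.congr_fun hR (0, c)
    simp only [map, permCongr_apply, hf', suspend_right_apply, hf] at h1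
    exact (Prod.mk.injEq _ _ _ _ ▸ h1).2
  · ext c
    have h1 := Equiv.congr_fun (congrArg (· ^ (k + 1)) hU) (0, c)
    simp only [map] at h1
    rw [permCongr_pow', permCongr_apply, hf', suspend_up_pow, suspend_up_pow, hf] at h1
    exact (Prod.mk.injEq _ _ _ _ ▸ h1).2
  · ext i c
    obtain ⟨c, rfl⟩ := f.surjective c
    have h1 := Set.ext_iff.1 (congrFun hZ i) (0, f c)
    rw [← hf] at h1
    simp only [map, φ.injective.mem_set_image] at h1
    simp only [map, f.injective.mem_set_image]
    rw [hf] at h1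
    simpa [suspend] using h1

end Suspend

end SquareData

namespace SquareData

variable {r : ℕ} {X : Type}

lemma zeros_subset_critical (D : SquareData r X) (i : Fin r) : D.zeros i ⊆ D.critical :=
  fun _ hs => ⟨0, i, hs⟩

/-- Below a regular row, neighbours in the row stay neighbours. -/
lemma IsSurface.up_inv_zpow {m : Fin r → ℕ} {D : SquareData r X} (hD : D.IsSurface m) {t : X}
    (ht : t ∉ D.critical) (j : ℤ) : D.up⁻¹ ((D.right ^ j) t) = (D.right ^ j) (D.up⁻¹ t) := by
  have hone : ∀ t, t ∉ D.critical → D.up⁻¹ (D.right t) = D.right (D.up⁻¹ t) := by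
    intro t ht
    have h := hD.turn_eq (D.right t) fun i hi => ht
      ((D.zpow_mem_critical 1 t).1 (by simpa using D.zeros_subset_critical i hi))
    rw [Perm.inv_eq_iff_eq]
    simpa [turn] using h.symm
  have hR : ∀ (j : ℤ), (D.right ^ j) t ∉ D.critical := fun j h => ht ((zpow_mem_critical _ _ _).1 h)
  induction j using Int.induction_on with
  | zero => simp
  | succ i ih =>
    rw [add_comm, zpow_add, zpow_one, Perm.mul_apply, Perm.mul_apply, hone _ (hR _), ih]
  | pred i ih =>
    have h := hone _ (hR (-i - 1))
    rw [← Perm.mul_apply D.right, ← zpow_one_add, show 1 + (-(i : ℤ) - 1) = -i by ring, ih] at h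
    have h2 : (D.right ^ (-(i : ℤ))) (D.up⁻¹ t) =
        D.right ((D.right ^ (-(i : ℤ) - 1)) (D.up⁻¹ t)) := by
      rw [← Perm.mul_apply D.right, ← zpow_one_add]
      congr 2
      ring
    rw [h2] at h
    exact (D.right.injective h).symm

/-- A surface with one cylinder is a cylinder over its bottom row, which consists of the squares
that have a zero at the bottom side of their row. -/
theorem IsSurface.exists_suspend [Finite X] {m : Fin r → ℕ} {D : SquareData r X}
    (hD : D.IsSurface m) (hone : D.OneCylinder) (hne : ∃ i, (D.zeros i).Nonempty) :
    ∃ (k w : ℕ) (D' : SquareData r (Fin w)) (e : Fin (k + 1) × Fin w ≃ X),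
      IsFullCycle D'.right ∧ (D'.suspend k).map e = D := by
  suffices h : ∃ (k : ℕ) (D' : SquareData r D.critical) (e : Fin (k + 1) × D.critical ≃ X),
      IsFullCycle D'.right ∧ (D'.suspend k).map e = D by
    obtain ⟨k, D', e, h1, h2⟩ := h
    let ψ := Finite.equivFin D.critical
    refine ⟨k, _, D'.map ψ, (Equiv.prodCongr (Equiv.refl _) ψ.symm).trans e,
      (isFullCycle_permCongr ψ _).2 h1, Eq.trans ?_ h2⟩
    rw [suspend_map, map_map]
    congr 1
    apply Equiv.ext
    rintro ⟨y, c⟩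
    exact congrArg e (Prod.ext rfl (ψ.symm_apply_apply c))
  classical
  obtain ⟨i₀, o, ho⟩ := hne
  have hoK : o ∈ D.critical := D.zeros_subset_critical i₀ ho
  have hRo : ∀ j : ℤ, (D.right ^ j) o ∈ D.critical := fun j => (zpow_mem_critical _ _ _).2 hoK
  -- the height of the cylinder
  have hex : ∃ y : ℕ, (D.up ^ (y + 1)) o ∈ D.critical := by
    obtain ⟨y, hy⟩ := Nat.exists_eq_succ_of_ne_zero (orderOf_pos D.up).ne'
    refine ⟨y, ?_⟩
    rw [← Nat.succ_eq_add_one, ← hy, pow_orderOf_eq_one]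
    exact hoK
  obtain ⟨k, hk, hmin⟩ : ∃ k : ℕ, (D.up ^ (k + 1)) o ∈ D.critical ∧
      ∀ y, y < k → (D.up ^ (y + 1)) o ∉ D.critical :=
    ⟨Nat.find hex, Nat.find_spec hex, fun y hy => Nat.find_min hex hy⟩
  have hcomm : ∀ y : ℕ, y ≤ k → ∀ j : ℤ, (D.up ^ y) ((D.right ^ j) o) =
      (D.right ^ j) ((D.up ^ y) o) := by
    intro y
    induction y with
    | zero => intro _ j; rfl
    | succ y ih =>
      intro hy j
      have h := hD.up_inv_zpow (hmin y hy) j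
      rw [Perm.inv_eq_iff_eq, pow_succ', Perm.mul_apply, Perm.coe_inv, symm_apply_apply,
        ← ih (by omega) j] at h
      rw [pow_succ', Perm.mul_apply, Perm.mul_apply, ← h]
  have hnot : ∀ y : ℕ, y ≠ 0 → y ≤ k → ∀ j : ℤ, (D.up ^ y) ((D.right ^ j) o) ∉ D.critical := by
    intro y hy hyk j
    obtain ⟨y, rfl⟩ := Nat.exists_eq_succ_of_ne_zero hy
    rw [hcomm _ hyk, zpow_mem_critical]
    exact hmin y hyk
  have htop : ∀ j : ℤ, (D.up ^ (k + 1)) ((D.right ^ j) o) ∈ D.critical := by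
    intro j
    by_contra hc
    have hj : ∀ x, (D.right ^ (-j)) ((D.right ^ j) x) = x := by simp
    have hU : ∀ x, D.up⁻¹ ((D.up ^ (k + 1)) x) = (D.up ^ k) x := by
      intro x
      rw [Perm.inv_eq_iff_eq, pow_succ', Perm.mul_apply]
    have h := hD.up_inv_zpow hc (-j)
    rw [Perm.inv_eq_iff_eq, hU, hcomm k le_rfl, hj, ← Perm.mul_apply D.up, ← pow_succ'] at h
    rw [← h, zpow_mem_critical] at hk
    exact hc hk
  have hall : ∀ s, ∃ y ≤ k, ∃ j : ℤ, s = (D.up ^ y) ((D.right ^ j) o) := by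
    intro s
    refine hone (fun s => ∃ y ≤ k, ∃ j : ℤ, s = (D.up ^ y) ((D.right ^ j) o)) (fun s => ⟨?_, ?_⟩)
      (fun s hs => ⟨?_, ?_⟩) o s ⟨0, Nat.zero_le _, 0, rfl⟩
    · rintro ⟨y, hy, j, h⟩
      refine ⟨y, hy, -1 + j, ?_⟩
      rw [hcomm y hy] at h ⊢
      rw [zpow_add, Perm.mul_apply, ← h]
      simp
    · rintro ⟨y, hy, j, h⟩
      refine ⟨y, hy, 1 + j, ?_⟩
      rw [hcomm y hy] at h ⊢
      rw [zpow_add, Perm.mul_apply, ← h, zpow_one]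
    · rintro ⟨y, hy, j, h⟩
      rcases y with _ | y
      · rw [h] at hs
        exact absurd (hRo j) hs
      · rw [pow_succ', Perm.mul_apply] at h
        exact ⟨y, by omega, j, D.up.injective h⟩
    · rintro ⟨y, hy, j, rfl⟩
      rw [← Perm.mul_apply, ← pow_succ'] at hs ⊢
      refine ⟨y + 1, ?_, j, rfl⟩
      by_contra hlt
      obtain rfl : y = k := by omega
      exact hs (htop j)
  have hcrit : ∀ c ∈ D.critical, ∃ j : ℤ, c = (D.right ^ j) o := by
    intro c hc
    obtain ⟨y, hy, j, rfl⟩ := hall c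
    by_cases hy0 : y = 0
    · exact ⟨j, by rw [hy0]; rfl⟩
    · exact absurd hc (hnot y hy0 hy j)
  have hmemR : ∀ x, D.right x ∈ D.critical ↔ x ∈ D.critical := by
    intro x
    simpa using D.zpow_mem_critical 1 x
  let D' : SquareData r D.critical :=
    { right := D.right.subtypePerm hmemR
      up := (D.up ^ (k + 1)).subtypePermOfFintype (p := (· ∈ D.critical)) (by
        intro c hc
        obtain ⟨j, rfl⟩ := hcrit c hc
        exact htop j)
      zeros := fun i => {c | c.1 ∈ D.zeros i} }
  have hinj' : ∀ (y y' : ℕ) (c c' : D.critical), y ≤ y' → y' ≤ k →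
      (D.up ^ y) c.1 = (D.up ^ y') c'.1 → y = y' ∧ c = c' := by
    intro y y' c c' hyy hy' h
    obtain ⟨d, rfl⟩ := Nat.exists_eq_add_of_le hyy
    rw [pow_add, Perm.mul_apply] at h
    have h' := (D.up ^ y).injective h
    obtain ⟨j, hj⟩ := hcrit c'.1 c'.2
    by_cases hd : d = 0
    · subst hd
      exact ⟨rfl, Subtype.ext h'⟩
    · exfalso
      refine hnot d hd (by omega) j ?_
      rw [← hj, ← h']
      exact c.2
  let e : Fin (k + 1) × D.critical ≃ X := Equiv.ofBijective
    (fun p => (D.up ^ p.1.val) p.2.1) ⟨by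
      rintro ⟨y, c⟩ ⟨y', c'⟩ h
      simp only at h
      rcases le_total y y' with hy | hy
      · obtain ⟨h1, h2⟩ := hinj' y y' c c' hy (by omega) h
        exact Prod.ext (Fin.ext h1) h2
      · obtain ⟨h1, h2⟩ := hinj' y' y c' c hy (by omega) h.symm
        exact Prod.ext (Fin.ext h1.symm) h2.symm, by
      intro s
      obtain ⟨y, hy, j, rfl⟩ := hall s
      exact ⟨(⟨y, by omega⟩, ⟨_, hRo j⟩), rfl⟩⟩
  have he : ∀ (y : Fin (k + 1)) (c : D.critical), e (y, c) = (D.up ^ y.val) c.1 := fun _ _ => rfl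
  have hperm : ∀ (P : Perm (Fin (k + 1) × D.critical)) (Q : Perm X),
      (∀ p, e (P p) = Q (e p)) → e.permCongr P = Q := by
    intro P Q h
    ext x
    rw [permCongr_apply, h, apply_symm_apply]
  refine ⟨k, D', e, ?_, ?_⟩
  · rintro ⟨a, ha⟩ ⟨b, hb⟩
    obtain ⟨i, rfl⟩ := hcrit a ha
    obtain ⟨j, rfl⟩ := hcrit b hb
    refine ⟨j - i, Subtype.ext ?_⟩
    change (((D.right.subtypePerm hmemR) ^ (j - i)) ⟨(D.right ^ i) o, ha⟩).1 = _
    rw [Perm.subtypePerm_zpow]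
    change (D.right ^ (j - i)) ((D.right ^ i) o) = _
    rw [← Perm.mul_apply, ← zpow_add, sub_add_cancel]
  · ext1
    · refine hperm _ _ ?_
      rintro ⟨y, c⟩
      rw [suspend_right_apply, he, he]
      change (D.up ^ y.val) (D.right c.1) = _
      obtain ⟨j, hj⟩ := hcrit c.1 c.2
      rw [hj, ← Perm.mul_apply D.right, ← zpow_one_add, hcomm _ (by omega), hcomm _ (by omega),
        ← Perm.mul_apply D.right, ← zpow_one_add]
    · refine hperm _ _ ?_
      rintro ⟨y, c⟩
      refine Fin.lastCases ?_ (fun y => ?_) y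
      · rw [suspend_up_last, he, he, Fin.val_last, Fin.val_zero, pow_zero, ← Perm.mul_apply,
          ← pow_succ']
        rfl
      · rw [suspend_up_castSucc, he, he, Fin.val_succ, Fin.val_castSucc, ← Perm.mul_apply,
          ← pow_succ']
    · ext i s
      constructor
      · rintro ⟨⟨y, c⟩, ⟨h0, hc⟩, rfl⟩
        simp only at h0
        rw [he, h0]
        exact hc
      · intro hs
        exact ⟨(0, ⟨s, D.zeros_subset_critical i hs⟩), ⟨rfl, hs⟩, rfl⟩

end SquareData

/-! ### Isomorphism classes of surfaces with one cylinder -/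

section Classes

variable {r : ℕ}

/-- The surfaces in the stratum of `m` whose squares, numbered by `X`, form a single row. -/
abbrev RowSurface (m : Fin r → ℕ) (X : Type) : Type :=
  {D : SquareData r X // D.IsSurface m ∧ IsFullCycle D.right}

/-- Renumbering the squares; the orbits are the isomorphism classes. -/
instance rowAction (m : Fin r → ℕ) (X : Type) : MulAction (Perm X) (RowSurface m X) where
  smul f D := ⟨D.1.map f, D.2.1.map f, (isFullCycle_permCongr f D.1.right).2 D.2.2⟩
  one_smul D := Subtype.ext (SquareData.map_refl D.1)
  mul_smul f g D := Subtype.ext (SquareData.map_map D.1 g f).symm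

lemma rowSurface_smul_val {m : Fin r → ℕ} {X : Type} (f : Perm X) (D : RowSurface m X) :
    (f • D).1 = D.1.map f := rfl

/-- The number of isomorphism classes of surfaces in the stratum of `m` that consist
of a single row of `w` squares. -/
noncomputable def numRow (m : Fin r → ℕ) (w : ℕ) : ℕ :=
  Nat.card (MulAction.orbitRel.Quotient (Perm (Fin w)) (RowSurface m (Fin w)))

instance {X : Type} [Finite X] : Finite (SquareData r X) :=
  Finite.of_injective (fun D => (D.right, D.up, D.zeros)) (by
    intro D E h
    simp only [Prod.mk.injEq] at h
    exact SquareData.ext h.1 h.2.1 h.2.2)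

lemma SquareData.IsSurface.zeros_nonempty {m : Fin r → ℕ} {X : Type} {D : SquareData r X}
    (hD : D.IsSurface m) (hr : 1 ≤ r) : ∃ i, (D.zeros i).Nonempty := by
  refine ⟨⟨0, hr⟩, Set.nonempty_of_ncard_ne_zero ?_⟩
  rw [hD.ncard_zeros]
  exact Nat.succ_ne_zero _

/-- A one-cylinder surface with `M` squares is determined by its width `w`, a divisor of `M`, and
the surface with a single row of `w` squares that its bottom row forms. -/
theorem ncard_oneCylinder (m : Fin r → ℕ) (hr : 1 ≤ r) {M : ℕ} (hM : M ≠ 0) :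
    ((Quotient.mk (Surface.isoSetoid m M)) '' {S : Surface m M | S.numCylinders = 1}).ncard =
      ∑ w ∈ M.divisors, numRow m w := by
  classical
  have hdiv : ∀ w : M.divisors, (M / w.1 - 1 + 1) * w.1 = M := by
    intro w
    have hw := Nat.dvd_of_mem_divisors w.2
    have hpos : 0 < M / w.1 :=
      Nat.div_pos (Nat.le_of_dvd (Nat.pos_of_ne_zero hM) hw) (Nat.pos_of_mem_divisors w.2)
    rw [Nat.sub_add_cancel hpos, Nat.div_mul_cancel hw]
  let e : ∀ w : M.divisors, Fin (M / w.1 - 1 + 1) × Fin w.1 ≃ Fin M := fun w =>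
    finProdFinEquiv.trans (finCongr (hdiv w))
  have hsurf : ∀ (w : M.divisors) (D : RowSurface m (Fin w.1)),
      ((D.1.suspend (M / w.1 - 1)).map (e w)).IsSurface m := fun w D =>
    ((SquareData.suspend_isSurface_iff D.2.2).2 D.2.1).map _
  choose S hS using fun (w : M.divisors) (D : RowSurface m (Fin w.1)) =>
    Surface.exists_toData_eq (hsurf w D)
  have hwd : ∀ (w : M.divisors) (D E : RowSurface m (Fin w.1)),
      (MulAction.orbitRel (Perm (Fin w.1)) _).r D E →
      (Quotient.mk (Surface.isoSetoid m M) (S w D)) = Quotient.mk _ (S w E) := by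
    rintro w D E ⟨f, hf⟩
    refine (Quotient.sound ((Surface.equiv_iff _ _).2 ?_)).symm
    have hf' : E.1.map f = D.1 := congrArg Subtype.val hf
    refine ⟨(e w).symm.trans ((Equiv.prodCongr (Equiv.refl _) f).trans (e w)), ?_⟩
    rw [hS, hS, SquareData.map_map, ← hf', SquareData.suspend_map, SquareData.map_map]
    congr 1
    ext p
    simp
  let F : (Σ w : M.divisors,
      MulAction.orbitRel.Quotient (Perm (Fin w.1)) (RowSurface m (Fin w.1))) →
      ((Quotient.mk (Surface.isoSetoid m M)) '' {S : Surface m M | S.numCylinders = 1}) :=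
    fun p => ⟨Quotient.lift (fun D => Quotient.mk (Surface.isoSetoid m M) (S p.1 D))
      (hwd p.1) p.2, by
        obtain ⟨w, q⟩ := p
        obtain ⟨D, rfl⟩ := Quotient.exists_rep q
        refine ⟨S w D, ?_, rfl⟩
        rw [Set.mem_ofPred_eq, Surface.numCylinders_eq_one_iff hM, hS]
        exact (SquareData.suspend_oneCylinder D.2.2 (D.2.1.zeros_nonempty hr)).map _⟩
  have hinj : Function.Injective F := by
    rintro ⟨w, q⟩ ⟨w', q'⟩ h
    obtain ⟨D, rfl⟩ := Quotient.exists_rep q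
    obtain ⟨D', rfl⟩ := Quotient.exists_rep q'
    have h1 : Quotient.mk (Surface.isoSetoid m M) (S w D) = Quotient.mk _ (S w' D') :=
      congrArg Subtype.val h
    obtain ⟨f, hf⟩ := (Surface.equiv_iff _ _).1 (Quotient.exact h1)
    rw [hS, hS, SquareData.map_map] at hf
    have hf' : (D.1.suspend (M / w.1 - 1)).map (((e w).trans f).trans (e w').symm) =
        D'.1.suspend (M / w'.1 - 1) := by
      rw [← SquareData.map_map, hf, SquareData.map_map]
      simp
    obtain ⟨g, hg⟩ := SquareData.exists_of_map_suspend_eq D.2.2 (D.2.1.zeros_nonempty hr)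
      D'.2.2 (D'.2.1.zeros_nonempty hr) _ hf'
    obtain rfl : w = w' := Subtype.ext (by simpa using Fintype.card_congr g)
    have hDD := SquareData.map_eq_of_map_suspend_eq g _ hf' hg
    refine Sigma.ext rfl (heq_of_eq (Quotient.sound ?_))
    exact ⟨g.symm, Subtype.ext (by
      rw [rowSurface_smul_val, ← hDD, SquareData.map_map]
      simp)⟩
  have hsurj : Function.Surjective F := by
    rintro ⟨_, T, hT, rfl⟩
    rw [Set.mem_ofPred_eq, Surface.numCylinders_eq_one_iff hM] at hT
    obtain ⟨k, w, D, φ, hR, hφ⟩ := T.isSurface_toData.exists_suspend hT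
      (T.isSurface_toData.zeros_nonempty hr)
    have hDs : D.IsSurface m := by
      rw [← SquareData.suspend_isSurface_iff (k := k) hR]
      have := T.isSurface_toData.map φ.symm
      rw [← hφ, SquareData.map_map] at this
      simpa using this
    have hcard : (k + 1) * w = M := by
      have := Nat.card_congr φ
      rwa [Nat.card_prod, Nat.card_fin, Nat.card_fin, Nat.card_fin] at this
    have hwM : w ∈ M.divisors := Nat.mem_divisors.2 ⟨⟨k + 1, by rw [mul_comm, hcard]⟩, hM⟩
    have hw0 : 0 < w := Nat.pos_of_mem_divisors hwM
    have hk : k = M / w - 1 := by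
      rw [← hcard, Nat.mul_div_cancel _ hw0, Nat.add_sub_cancel]
    refine ⟨⟨⟨w, hwM⟩, Quotient.mk _ ⟨D, hDs, hR⟩⟩, Subtype.ext ?_⟩
    change Quotient.mk (Surface.isoSetoid m M) (S ⟨w, hwM⟩ ⟨D, hDs, hR⟩) = Quotient.mk _ T
    refine Quotient.sound ((Surface.equiv_iff _ _).2 ?_)
    rw [hS]
    generalize e ⟨w, hwM⟩ = e'
    simp only at e' ⊢
    subst hk
    refine ⟨e'.symm.trans φ, ?_⟩
    rw [SquareData.map_map, ← hφ]
    congr 1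
    ext p
    simp
  rw [← Nat.card_coe_set_eq, ← Nat.card_congr (Equiv.ofBijective F ⟨hinj, hsurj⟩), Nat.card_sigma,
    ← Finset.sum_coe_sort M.divisors]
  rfl

end Classes

/-! ### Counting surfaces with a single row -/

section Prongs

variable {r : ℕ} (m : Fin r → ℕ)

/-- The horizontal saddle connections: `m i + 1` of them start at the `i`-th zero. -/
abbrev Prong : Type := Σ i : Fin r, Fin (m i + 1)

/-- The turn by `2π` around the zeros. -/
def prongTurn : Perm (Prong m) := Equiv.sigmaCongrRight fun i => finRotate (m i + 1)

lemma card_prong : Nat.card (Prong m) = ∑ i, (m i + 1) := by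
  rw [Nat.card_sigma]
  simp

lemma prongTurn_apply (i : Fin r) (s : Fin (m i + 1)) :
    prongTurn m ⟨i, s⟩ = ⟨i, finRotate (m i + 1) s⟩ := rfl

lemma prongTurn_pow (i : Fin r) (s : Fin (m i + 1)) :
    (prongTurn m ^ s.val) ⟨i, 0⟩ = ⟨i, s⟩ := by
  induction s using Fin.induction with
  | zero => rfl
  | succ s ih =>
    rw [Fin.val_castSucc] at ih
    rw [Fin.val_succ, pow_succ', Perm.mul_apply, ih, prongTurn_apply]
    congr 1
    apply Fin.ext
    rw [coe_finRotate_of_ne_last (Fin.castSucc_lt_last s).ne]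
    simp

variable {m} {X : Type}

/-- An injection of `Prong m` splits `X` into its image and the complement. -/
noncomputable def splitEquiv (e : Prong m ↪ X) :
    Prong m ⊕ {x // x ∉ Set.range e} ≃ X := by
  classical
  exact (Equiv.sumCongr (Equiv.ofInjective e e.injective) (Equiv.refl _)).trans
    (Equiv.sumCompl (· ∈ Set.range e))

/-- The permutation of `X` that acts as the turn on the image of `e`. -/
noncomputable def turnVia (e : Prong m ↪ X) : Perm X :=
  (splitEquiv e).permCongr (Equiv.sumCongr (prongTurn m) (1 : Perm {x // x ∉ Set.range e}))

lemma splitEquiv_inl (e : Prong m ↪ X) (j : Prong m) : splitEquiv e (Sum.inl j) = e j := by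
  simp [splitEquiv]

lemma splitEquiv_inr (e : Prong m ↪ X) (x : {x // x ∉ Set.range e}) :
    splitEquiv e (Sum.inr x) = x := by
  simp [splitEquiv]

lemma turnVia_apply (e : Prong m ↪ X) (j : Prong m) : turnVia e (e j) = e (prongTurn m j) := by
  rw [turnVia, permCongr_apply, ← splitEquiv_inl, symm_apply_apply]
  simp [splitEquiv_inl]

lemma turnVia_apply_of_notMem (e : Prong m ↪ X) {x : X} (hx : x ∉ Set.range e) :
    turnVia e x = x := by
  have h : splitEquiv e (Sum.inr ⟨x, hx⟩) = x := splitEquiv_inr e _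
  rw [turnVia, permCongr_apply]
  nth_rewrite 1 [← h]
  rw [symm_apply_apply]
  simp [splitEquiv_inr]

lemma eq_turnVia (e : Prong m ↪ X) {α : Perm X} (h1 : ∀ j, α (e j) = e (prongTurn m j))
    (h2 : ∀ x ∉ Set.range e, α x = x) : α = turnVia e := by
  ext x
  by_cases hx : x ∈ Set.range e
  · obtain ⟨j, rfl⟩ := hx
    rw [h1, turnVia_apply]
  · rw [h2 x hx, turnVia_apply_of_notMem e hx]

lemma turnVia_pow (e : Prong m ↪ X) (i : Fin r) (s : Fin (m i + 1)) :
    (turnVia e ^ s.val) (e ⟨i, 0⟩) = e ⟨i, s⟩ := by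
  have h : ∀ n : ℕ, ∀ j, (turnVia e ^ n) (e j) = e ((prongTurn m ^ n) j) := by
    intro n
    induction n with
    | zero => simp
    | succ n ih => intro j; rw [pow_succ', pow_succ', Perm.mul_apply, Perm.mul_apply, ih,
        turnVia_apply]
  rw [h, prongTurn_pow]

lemma sameCycle_turnVia (e : Prong m ↪ X) (i : Fin r) :
    {t | (turnVia e).SameCycle (e ⟨i, 0⟩) t} = Set.range fun s => e ⟨i, s⟩ := by
  ext t
  rw [Set.mem_ofPred_eq, Set.mem_range]
  constructor
  · rintro ⟨j, rfl⟩
    have hone : ∀ x, (∃ s, e ⟨i, s⟩ = turnVia e x) ↔ ∃ s, e ⟨i, s⟩ = x := by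
      intro x
      constructor
      · rintro ⟨s, hs⟩
        refine ⟨(finRotate (m i + 1)).symm s, ?_⟩
        apply (turnVia e).injective
        rw [← hs, turnVia_apply, prongTurn_apply, apply_symm_apply]
      · rintro ⟨s, rfl⟩
        exact ⟨finRotate (m i + 1) s, by rw [turnVia_apply, prongTurn_apply]⟩
    induction j using Int.induction_on with
    | zero => exact ⟨0, rfl⟩
    | succ n ih => rwa [add_comm (n : ℤ), zpow_add, zpow_one, Perm.mul_apply, hone]
    | pred n ih =>
      rw [← hone, ← Perm.mul_apply, ← zpow_one_add]
      convert ih using 5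
      ring
  · rintro ⟨s, rfl⟩
    exact ⟨s.val, by rw [zpow_natCast, turnVia_pow]⟩

lemma numFull_sumCongr_one {X Y : Type} [Finite X] [Nonempty X] [Finite Y] (α : Perm X) :
    numFull (sumCongr α (1 : Perm Y)) * (Nat.card X - 1).factorial =
      (Nat.card (X ⊕ Y) - 1).factorial * numFull α := by
  let ψ := Equiv.sumCongr (Equiv.refl X) (Finite.equivFin Y)
  have h : ψ.permCongr (sumCongr α (1 : Perm Y)) =
      sumCongr α (1 : Perm (Fin (Nat.card Y))) := by
    apply Equiv.ext
    rintro (x | y) <;> simp [ψ]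
  rw [← numFull_permCongr ψ, h, numFull_sumCongr, Nat.card_sum]

/-- All points outside of the image of `e` are fixed by the turn, and can be deleted. -/
lemma numFull_turnVia [Finite X] (hr : 1 ≤ r) (e : Prong m ↪ X) :
    numFull (turnVia e) * (∑ i, (m i + 1) - 1).factorial =
      (Nat.card X - 1).factorial * numFull (prongTurn m) := by
  have : Nonempty (Prong m) := ⟨⟨⟨0, hr⟩, 0⟩⟩
  rw [turnVia, numFull_permCongr, ← card_prong, numFull_sumCongr_one,
    Nat.card_congr (splitEquiv e)]

end Prongs

section Count

variable {r : ℕ} {m : Fin r → ℕ} {X : Type}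

/-- The surface with a single row that is given by `R`, `U` and an injection `e` that parametrizes
the corners at the zeros. -/
noncomputable def rowOfProngs (e : Prong m ↪ X) {R U : Perm X} (hR : IsFullCycle R)
    (hU : U * R * U⁻¹ = turnVia e * R) : RowSurface m X :=
  ⟨{ right := R, up := U, zeros := fun i => Set.range fun s => e ⟨i, s⟩ }, by
    have ht : SquareData.turn (r := r)
        { right := R, up := U, zeros := fun i => Set.range fun s => e ⟨i, s⟩ } = turnVia e := by
      rw [SquareData.turn, hU, mul_inv_cancel_right]
    refine ⟨⟨SquareData.isFullCycle_isPretransitive (r := r) (D := ⟨R, U, fun _ => ∅⟩) hR,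
      fun i => ⟨e ⟨i, 0⟩, ?_⟩, fun i j hij => ?_, fun i => ?_, fun s hs => ?_⟩, hR⟩
    · rw [ht, sameCycle_turnVia]
    · have h : e ⟨i, 0⟩ ∈ Set.range fun s => e ⟨j, s⟩ := by
        have h0 : e ⟨i, 0⟩ ∈ Set.range fun s => e ⟨i, s⟩ := ⟨0, rfl⟩
        rwa [show (Set.range fun s => e ⟨i, s⟩) = Set.range fun s => e ⟨j, s⟩ from hij] at h0
      obtain ⟨s, hs⟩ := h
      exact (congrArg Sigma.fst (e.injective hs)).symm
    · change (Set.range fun s => e ⟨i, s⟩).ncard = _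
      rw [← Set.image_univ, Set.ncard_image_of_injective, Set.ncard_univ, Nat.card_fin]
      exact e.injective.comp sigma_mk_injective
    · rw [ht]
      refine turnVia_apply_of_notMem e ?_
      rintro ⟨⟨i, j⟩, rfl⟩
      exact hs i ⟨j, rfl⟩⟩

/-- A choice of one corner at each zero extends to a parametrization of all corners at zeros by
`Prong m`. -/
lemma SquareData.IsSurface.exists_prongs [Finite X] {D : SquareData r X} (hD : D.IsSurface m)
    (b : Fin r → X)
    (hb : ∀ i, b i ∈ D.zeros i) : ∃ e : Prong m ↪ X, (∀ i, e ⟨i, 0⟩ = b i) ∧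
      (∀ i, D.zeros i = Set.range fun s => e ⟨i, s⟩) ∧ D.turn = turnVia e := by
  have hz : ∀ i, D.zeros i = {t | D.turn.SameCycle (b i) t} := by
    intro i
    obtain ⟨s, hs⟩ := hD.zeros_eq i
    have hb : D.turn.SameCycle s (b i) := by
      have := hb i
      rwa [hs] at this
    rw [hs]
    ext t
    exact ⟨hb.symm.trans, hb.trans⟩
  have hper : ∀ i, Function.minimalPeriod D.turn (b i) = m i + 1 := by
    intro i
    have := Fintype.ofFinite (MulAction.orbit (Subgroup.zpowers D.turn) (b i))
    have h := MulAction.minimalPeriod_eq_card (α := Perm X) (a := D.turn) (b := b i)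
    rw [← Nat.card_eq_fintype_card, Nat.card_coe_set_eq] at h
    rw [← hD.ncard_zeros i, hz i]
    refine h.trans (congrArg Set.ncard ?_)
    ext t
    constructor
    · rintro ⟨⟨_, k, rfl⟩, hk⟩
      exact ⟨k, hk⟩
    · rintro ⟨k, hk⟩
      exact ⟨⟨_, k, rfl⟩, hk⟩
  have hinj : Function.Injective fun j : Prong m => (D.turn ^ j.2.val) (b j.1) := by
    rintro ⟨i, s⟩ ⟨j, t⟩ h
    simp only at h
    have hij : i = j := by
      apply hD.injective
      rw [hz i, hz j]
      have h1 : D.turn.SameCycle (b i) (b j) := by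
        have hi : D.turn.SameCycle (b i) ((D.turn ^ s.val) (b i)) :=
          ⟨s.val, by rw [zpow_natCast]⟩
        have hj : D.turn.SameCycle (b j) ((D.turn ^ t.val) (b j)) :=
          ⟨t.val, by rw [zpow_natCast]⟩
        rw [h] at hi
        exact hi.trans hj.symm
      ext x
      exact ⟨h1.symm.trans, h1.trans⟩
    subst hij
    congr 1
    apply Fin.ext
    refine Function.iterate_injOn_Iio_minimalPeriod (f := D.turn) (x := (b i)) ?_ ?_ ?_
    · rw [Set.mem_Iio, hper]; exact s.2
    · rw [Set.mem_Iio, hper]; exact t.2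
    · simpa [Perm.iterate_eq_pow] using h
  have hrange : ∀ i, D.zeros i = Set.range fun s : Fin (m i + 1) => (D.turn ^ s.val) (b i) := by
    intro i
    symm
    refine Set.eq_of_subset_of_ncard_le ?_ ?_ (Set.toFinite _)
    · rintro _ ⟨s, rfl⟩
      rw [hz i]
      exact ⟨s.val, by rw [zpow_natCast]⟩
    · rw [hD.ncard_zeros, ← Set.image_univ, Set.ncard_image_of_injective, Set.ncard_univ,
        Nat.card_fin]
      exact hinj.comp (g := fun j : Prong m => (D.turn ^ j.2.val) (b j.1)) sigma_mk_injective
  refine ⟨⟨_, hinj⟩, fun i => rfl, hrange, ?_⟩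
  apply eq_turnVia
  · rintro ⟨i, s⟩
    change D.turn ((D.turn ^ s.val) (b i)) = (D.turn ^ (finRotate (m i + 1) s).val) (b i)
    rw [← Perm.mul_apply, ← pow_succ']
    by_cases hs : s = Fin.last (m i)
    · have h0 : (finRotate (m i + 1) s).val = 0 := by rw [hs, finRotate_last]; rfl
      have h1 : s.val + 1 = Function.minimalPeriod D.turn (b i) := by rw [hper, hs, Fin.val_last]
      rw [h0, h1, ← Perm.iterate_eq_pow, Function.iterate_minimalPeriod]
      rfl
    · rw [coe_finRotate_of_ne_last hs]
  · intro x hx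
    refine hD.turn_eq x fun i hi => hx ?_
    rw [hrange i] at hi
    obtain ⟨s, rfl⟩ := hi
    exact ⟨⟨i, s⟩, rfl⟩

lemma rowOfProngs_turn (e : Prong m ↪ X) {R U : Perm X} (hR : IsFullCycle R)
    (hU : U * R * U⁻¹ = turnVia e * R) : (rowOfProngs e hR hU).1.turn = turnVia e := by
  change U * R * U⁻¹ * R⁻¹ = _
  rw [hU, mul_inv_cancel_right]

/-- A parametrization of the corners at the zeros is determined by the turn and the base corners. -/
lemma eq_of_turnVia_eq {e e' : Prong m ↪ X} (h : turnVia e = turnVia e')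
    (h0 : ∀ i, e ⟨i, 0⟩ = e' ⟨i, 0⟩) : e = e' := by
  ext ⟨i, s⟩
  rw [← turnVia_pow e i s, ← turnVia_pow e' i s, h, h0]

/-- Surfaces with a single row and a choice of one corner at each zero are
parametrized by injections `e` of the prongs, full cycles `R` such that `turnVia e * R` is a
full cycle, and the permutations that conjugate the former to the latter. -/
noncomputable def basedRowEquiv [Finite X] :
    (Σ e : Prong m ↪ X, Σ R : {R : Perm X // IsFullCycle R ∧ IsFullCycle (turnVia e * R)},
      {U : Perm X // U * R.1 * U⁻¹ = turnVia e * R.1}) ≃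
      Σ D : RowSurface m X, ∀ i, D.1.zeros i :=
  Equiv.ofBijective (fun p => ⟨rowOfProngs p.1 p.2.1.2.1 p.2.2.2,
    fun i => ⟨p.1 ⟨i, 0⟩, ⟨0, rfl⟩⟩⟩) (by
      constructor
      · rintro ⟨e, ⟨R, hR, hR2⟩, U, hU⟩ ⟨e', ⟨R', hR', hR2'⟩, U', hU'⟩ h
        have h1 : rowOfProngs e hR hU = rowOfProngs e' hR' hU' := congrArg Sigma.fst h
        have h2 : ∀ i, e ⟨i, 0⟩ = e' ⟨i, 0⟩ := by
          intro i
          exact congrArg (fun q : Σ D : RowSurface m X, ∀ i, D.1.zeros i => (q.2 i).1) h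
        have h3 : turnVia e = turnVia e' := by
          rw [← rowOfProngs_turn e hR hU, h1, rowOfProngs_turn]
        obtain rfl := eq_of_turnVia_eq h3 h2
        obtain rfl : R = R' := congrArg (fun D : RowSurface m X => D.1.right) h1
        obtain rfl : U = U' := congrArg (fun D : RowSurface m X => D.1.up) h1
        rfl
      · rintro ⟨⟨D, hD, hR⟩, b⟩
        obtain ⟨e, h0, hz, ht⟩ := hD.exists_prongs (fun i => (b i).1) fun i => (b i).2
        have hU : D.up * D.right * D.up⁻¹ = turnVia e * D.right := by
          rw [← ht, SquareData.turn, inv_mul_cancel_right]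
        refine ⟨⟨e, ⟨D.right, hR, hU ▸ hR.conj D.up⟩, D.up, hU⟩, ?_⟩
        have hDD : rowOfProngs e hR hU = ⟨D, hD, hR⟩ := by
          apply Subtype.ext
          ext1
          · rfl
          · rfl
          · exact (funext hz).symm
        refine Sigma.ext hDD ?_
        refine Function.hfunext rfl ?_
        rintro i _ ⟨⟩
        refine (Subtype.heq_iff_coe_eq ?_).2 (h0 i)
        intro x
        exact Set.ext_iff.1 (congrArg (fun D : RowSurface m X => D.1.zeros i) hDD) x)

lemma card_rowSurface [Finite X] [Nonempty X] (hr : 1 ≤ r) :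
    Nat.card (RowSurface m X) * (∏ i, (m i + 1)) * (∑ i, (m i + 1) - 1).factorial =
      (Nat.card X).factorial * (Nat.card X).descFactorial (∑ i, (m i + 1)) *
        numFull (prongTurn m) := by
  classical
  have := Fintype.ofFinite X
  have := Fintype.ofFinite (RowSurface m X)
  have := Fintype.ofFinite (Prong m ↪ X)
  have h := Nat.card_congr (basedRowEquiv (m := m) (X := X))
  rw [Nat.card_sigma, Nat.card_sigma] at h
  have h1 : ∀ D : RowSurface m X, Nat.card (∀ i, D.1.zeros i) = ∏ i, (m i + 1) := by
    intro D
    rw [Nat.card_pi]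
    refine Finset.prod_congr rfl fun i _ => ?_
    rw [Nat.card_coe_set_eq, D.2.1.ncard_zeros]
  have h2 : ∀ e : Prong m ↪ X,
      Nat.card (Σ R : {R : Perm X // IsFullCycle R ∧ IsFullCycle (turnVia e * R)},
        {U : Perm X // U * R.1 * U⁻¹ = turnVia e * R.1}) = numFull (turnVia e) * Nat.card X := by
    intro e
    have := Fintype.ofFinite {R : Perm X // IsFullCycle R ∧ IsFullCycle (turnVia e * R)}
    rw [Nat.card_sigma, Finset.sum_congr rfl (fun R _ => card_conj_eq R.2.1 R.2.2),
      Finset.sum_const, Finset.card_univ, ← Nat.card_eq_fintype_card, smul_eq_mul]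
    rfl
  rw [Finset.sum_congr rfl (fun D _ => h1 D), Finset.sum_congr rfl (fun e _ => h2 e),
    Finset.sum_const, Finset.card_univ, ← Nat.card_eq_fintype_card, smul_eq_mul] at h
  rw [← h, Finset.sum_mul, Finset.sum_congr rfl (fun e _ => by
    rw [mul_right_comm, numFull_turnVia hr, mul_right_comm, mul_comm _ (Nat.card X),
      Nat.mul_factorial_pred Nat.card_pos.ne']), Finset.sum_const, Finset.card_univ,
      Fintype.card_embedding_eq, ← Nat.card_eq_fintype_card, ← Nat.card_eq_fintype_card, card_prong,
      smul_eq_mul]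
  ring

end Count

/-! ### Surfaces with symmetries and the asymptotics of the row count -/

section Symmetric

variable {r : ℕ} {m : Fin r → ℕ} {X : Type}

/-- A permutation that commutes with a full cycle and has a fixed point is the identity. -/
lemma IsFullCycle.eq_one {R f : Perm X} (hR : IsFullCycle R) (hf : f * R = R * f) {x : X}
    (hx : f x = x) : f = 1 := by
  ext y
  obtain ⟨j, rfl⟩ := hR x y
  have hc : Commute f (R ^ j) := Commute.zpow_right (a := f) (b := R) hf j
  rw [← Perm.mul_apply, hc.eq, Perm.mul_apply, hx, Perm.one_apply]

lemma card_zpowers_pow_eq_one_le [Finite X] (R : Perm X) {q : ℕ} (hq : 0 < q) :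
    Nat.card {f : Perm X // f ∈ Subgroup.zpowers R ∧ f ^ q = 1} ≤ q := by
  classical
  have := Fintype.ofFinite (Subgroup.zpowers R)
  have h := IsCyclic.card_pow_eq_one_le (α := Subgroup.zpowers R) hq
  rw [← Fintype.card_subtype, ← Nat.card_eq_fintype_card] at h
  refine le_trans (Nat.card_le_card_of_injective (fun f => ⟨⟨f.1, f.2.1⟩,
    Subtype.ext f.2.2⟩) ?_) h
  · rintro ⟨f, hf⟩ ⟨g, hg⟩ h
    simpa using h

/-- A nontrivial automorphism of a surface with a single row is a translation of the row whose
order divides `m i + 1`.  It maps some corner at the `i`-th zero to another one, which leaves only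
`n - 1` of the `n` corners at the zeros to be chosen freely. -/
lemma card_symmetric_le [Finite X] [Nonempty X] (i : Fin r) :
    Nat.card {p : Perm X × RowSurface m X // p.1 ≠ 1 ∧ p.1 • p.2 = p.2} ≤
      (m i + 1) ^ 2 * (Nat.card X).factorial * Nat.card X ^ (∑ i, (m i + 1) - 1) := by
  classical
  have hex : ∀ D : RowSurface m X, ∃ e : Prong m ↪ X,
      (∀ i, D.1.zeros i = Set.range fun s => e ⟨i, s⟩) ∧ D.1.turn = turnVia e := by
    intro D
    have hne : ∀ i, (D.1.zeros i).Nonempty := by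
      intro i
      refine Set.nonempty_of_ncard_ne_zero ?_
      rw [D.2.1.ncard_zeros]
      exact Nat.succ_ne_zero _
    choose b hb using hne
    obtain ⟨e, -, h1, h2⟩ := D.2.1.exists_prongs b hb
    exact ⟨e, h1, h2⟩
  choose e hz ht using hex
  obtain ⟨o⟩ := ‹Nonempty X›
  have hcR : ∀ (f : Perm X) (D : RowSurface m X), f • D = D → f * D.1.right = D.1.right * f := by
    intro f D h
    have h1 : f * D.1.right * f⁻¹ = D.1.right := congrArg (fun D : RowSurface m X => D.1.right) h
    exact mul_inv_eq_iff_eq_mul.1 h1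
  have hct : ∀ (f : Perm X) (D : RowSurface m X), f • D = D →
      Commute f (turnVia (e D)) := by
    intro f D h
    have h1 : (D.1.map f).turn = D.1.turn := congrArg (fun D : RowSurface m X => D.1.turn) h
    rw [SquareData.turn_map, ht] at h1
    exact mul_inv_eq_iff_eq_mul.1 h1
  have hs : ∀ (f : Perm X) (D : RowSurface m X), f • D = D →
      ∃ s, f (e D ⟨i, 0⟩) = e D ⟨i, s⟩ := by
    intro f D h
    have h1 : f '' D.1.zeros i = D.1.zeros i :=
      congrArg (fun D : RowSurface m X => D.1.zeros i) h
    have h2 : f (e D ⟨i, 0⟩) ∈ D.1.zeros i := by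
      rw [← h1, hz]
      exact ⟨_, ⟨0, rfl⟩, rfl⟩
    rw [hz] at h2
    obtain ⟨s, hs⟩ := h2
    exact ⟨s, hs.symm⟩
  choose s hs using hs
  -- `f` acts on the corner `⟨i, 0⟩` as a power of the turn, which has order `m i + 1` there, and
  -- a symmetry with a fixed corner is the identity
  have hpow : ∀ (f : Perm X) (D : RowSurface m X), f • D = D → f ^ (m i + 1) = 1 := by
    intro f D h
    have hturn : (turnVia (e D) ^ (m i + 1)) (e D ⟨i, 0⟩) = e D ⟨i, 0⟩ := by
      have h1 := turnVia_pow (e D) i (Fin.last (m i))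
      rw [Fin.val_last] at h1
      rw [pow_succ', Perm.mul_apply, h1, turnVia_apply, prongTurn_apply, finRotate_last]
    have hj : ∀ j : ℕ, (f ^ j) (e D ⟨i, 0⟩) =
        (turnVia (e D) ^ (j * (s f D h).val)) (e D ⟨i, 0⟩) := by
      intro j
      induction j with
      | zero => simp
      | succ j ih =>
        have hc : Commute f (turnVia (e D) ^ (j * (s f D h).val)) := (hct f D h).pow_right _
        rw [pow_succ', Perm.mul_apply, ih, ← Perm.mul_apply, hc.eq, Perm.mul_apply, hs f D h,
          ← turnVia_pow, ← Perm.mul_apply, ← pow_add, ← Nat.succ_mul]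
    have hc : f ^ (m i + 1) * D.1.right = D.1.right * f ^ (m i + 1) :=
      Commute.pow_left (a := f) (b := D.1.right) (hcR f D h) _
    refine D.2.2.eq_one hc (x := e D ⟨i, 0⟩) ?_
    rw [hj, pow_mul, ← Perm.iterate_eq_pow]
    exact Function.iterate_fixed hturn _
  have hs0 : ∀ (f : Perm X) (D : RowSurface m X) (h : f • D = D), f ≠ 1 → s f D h ≠ 0 := by
    intro f D h hf hs'
    have h1 := hs f D h
    rw [hs'] at h1
    exact hf (D.2.2.eq_one (hcR f D h) h1)
  -- the row `R`, the symmetry `f`, the corners other than `f (e ⟨i, 0⟩)`, and one value of `U`,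
  -- which determines `U` because it conjugates `R` to a known full cycle
  let T : Type := (Σ R : {R : Perm X // IsFullCycle R},
      {f : Perm X // f ∈ Subgroup.zpowers R.1 ∧ f ^ (m i + 1) = 1}) ×
    (Σ t : Fin (m i + 1), ({j : Prong m // j ≠ ⟨i, t⟩} → X)) × X
  let F : {p : Perm X × RowSurface m X // p.1 ≠ 1 ∧ p.1 • p.2 = p.2} → T := fun p =>
    (⟨⟨p.1.2.1.right, p.1.2.2.2⟩, ⟨p.1.1, by
        have : Nonempty X := ⟨o⟩
        obtain ⟨k, hk⟩ := p.1.2.2.2.exists_zpow (hcR _ _ p.2.2)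
        exact ⟨k, hk.symm⟩, hpow _ _ p.2.2⟩⟩,
      ⟨s _ _ p.2.2, fun j => e p.1.2 j.1⟩, p.1.2.1.up o)
  have hF : Function.Injective F := by
    rintro ⟨⟨f, D⟩, hf, h⟩ ⟨⟨f', D'⟩, hf', h'⟩ heq
    have hR : D.1.right = D'.1.right := congrArg (fun t : T => t.1.1.1) heq
    obtain rfl : f = f' := congrArg (fun t : T => t.1.2.1) heq
    have hst : s f D h = s f D' h' := congrArg (fun t : T => t.2.1.1) heq
    have hU : D.1.up o = D'.1.up o := congrArg (fun t : T => t.2.2) heq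
    have hfn : ∀ j : Prong m, j ≠ ⟨i, s f D h⟩ → e D j = e D' j := by
      intro j hj
      have h1 : (⟨s f D h, fun j => e D j.1⟩ :
          Σ t : Fin (m i + 1), ({j : Prong m // j ≠ ⟨i, t⟩} → X)) =
          ⟨s f D' h', fun j => e D' j.1⟩ := congrArg (fun t : T => t.2.1) heq
      have h2 := congrArg (fun u : Σ t : Fin (m i + 1), ({j : Prong m // j ≠ ⟨i, t⟩} → X) =>
        if hu : j ≠ ⟨i, u.1⟩ then u.2 ⟨j, hu⟩ else o) h1
      simp only at h2
      rwa [dif_pos hj, dif_pos (hst ▸ hj)] at h2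
    have hee : e D = e D' := by
      ext j
      by_cases hj : j = ⟨i, s f D h⟩
      · rw [hj, ← hs f D h, hfn ⟨i, 0⟩ (fun h0 => hs0 f D h hf (by simpa using h0.symm)),
          hs f D' h', hst]
      · exact hfn j hj
    have hUU : D.1.up = D'.1.up := by
      have hconj : ∀ D : RowSurface m X, D.1.up * D.1.right * D.1.up⁻¹ =
          turnVia (e D) * D.1.right := by
        intro D
        rw [← ht, SquareData.turn, inv_mul_cancel_right]
      have hk : ∀ (D : RowSurface m X) (k : ℤ), D.1.up * D.1.right ^ k =
          (turnVia (e D) * D.1.right) ^ k * D.1.up := by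
        intro D k
        rw [← hconj, conj_zpow]; group
      ext x
      obtain ⟨k, rfl⟩ := D.2.2 o x
      rw [← Perm.mul_apply, hk, Perm.mul_apply, hU, hee, hR, ← Perm.mul_apply, ← hk,
        Perm.mul_apply]
    have hDD : D = D' := by
      apply Subtype.ext
      ext1
      · exact hR
      · exact hUU
      · funext i
        rw [hz, hz, hee]
    subst hDD
    rfl
  have := Fintype.ofFinite {R : Perm X // IsFullCycle R}
  have hcard : Nat.card T ≤ ((Nat.card X - 1).factorial * (m i + 1)) *
      (((m i + 1) * Nat.card X ^ (∑ i, (m i + 1) - 1)) * Nat.card X) := by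
    rw [Nat.card_prod, Nat.card_prod]
    refine Nat.mul_le_mul ?_ (Nat.mul_le_mul ?_ le_rfl)
    · rw [Nat.card_sigma, ← card_isFullCycle, Nat.card_eq_fintype_card, ← Finset.card_univ,
        ← smul_eq_mul]
      exact Finset.sum_le_card_nsmul _ _ _ fun R _ =>
        card_zpowers_pow_eq_one_le R.1 (Nat.succ_pos _)
    · rw [Nat.card_sigma]
      have h1 : ∀ t : Fin (m i + 1), Nat.card ({j : Prong m // j ≠ ⟨i, t⟩} → X) =
          Nat.card X ^ (∑ i, (m i + 1) - 1) := by
        intro t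
        rw [Nat.card_fun, ← card_prong]
        congr 1
        rw [Nat.card_eq_fintype_card, Nat.card_eq_fintype_card, Fintype.card_subtype_compl,
          Fintype.card_subtype_eq]
      rw [Finset.sum_congr rfl (fun t _ => h1 t), Finset.sum_const, Finset.card_univ,
        Fintype.card_fin, smul_eq_mul]
  refine (Nat.card_le_card_of_injective F hF).trans (hcard.trans (le_of_eq ?_))
  have : Nonempty X := ⟨o⟩
  rw [← Nat.mul_factorial_pred (Nat.card_pos (α := X)).ne']
  ring

end Symmetric

section NumRow

variable {r : ℕ} {m : Fin r → ℕ}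

/-- Burnside's lemma, with the contribution of the identity split off. -/
lemma numRow_mul_factorial (m : Fin r → ℕ) (w : ℕ) :
    numRow m w * w.factorial = Nat.card (RowSurface m (Fin w)) +
      Nat.card {p : Perm (Fin w) × RowSurface m (Fin w) // p.1 ≠ 1 ∧ p.1 • p.2 = p.2} := by
  classical
  have := Fintype.ofFinite (RowSurface m (Fin w))
  have := Fintype.ofFinite (MulAction.orbitRel.Quotient (Perm (Fin w)) (RowSurface m (Fin w)))
  have h := MulAction.sum_card_fixedBy_eq_card_orbits_mul_card_group (Perm (Fin w))
    (RowSurface m (Fin w))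
  rw [Fintype.card_perm, Fintype.card_fin, ← Nat.card_eq_fintype_card] at h
  rw [numRow, ← h, ← Finset.add_sum_erase _ _ (Finset.mem_univ (1 : Perm (Fin w)))]
  congr 1
  · rw [← Nat.card_eq_fintype_card]
    refine Nat.card_congr (Equiv.subtypeUnivEquiv fun D => ?_)
    exact one_smul _ D
  · rw [Finset.sum_subtype (p := fun f : Perm (Fin w) => f ≠ 1) _ (by simp)]
    simp_rw [← Nat.card_eq_fintype_card]
    rw [← Nat.card_sigma]
    refine Nat.card_congr ⟨fun p => ⟨(p.1.1, p.2.1), p.1.2, p.2.2⟩,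
      fun p => ⟨⟨p.1.1, p.2.1⟩, ⟨p.1.2, p.2.2⟩⟩, fun _ => rfl, fun _ => rfl⟩

/-- Up to the surfaces with symmetries, an isomorphism class of row surfaces has `w!` numberings. -/
lemma numRow_bounds (hr : 1 ≤ r) {w : ℕ} (hw : 1 ≤ w) :
    w.descFactorial (∑ i, (m i + 1)) * numFull (prongTurn m) ≤
        numRow m w * ((∏ i, (m i + 1)) * (∑ i, (m i + 1) - 1).factorial) ∧
      numRow m w * ((∏ i, (m i + 1)) * (∑ i, (m i + 1) - 1).factorial) ≤
        w.descFactorial (∑ i, (m i + 1)) * numFull (prongTurn m) +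
        (m ⟨0, hr⟩ + 1) ^ 2 * ((∏ i, (m i + 1)) * (∑ i, (m i + 1) - 1).factorial) *
          w ^ (∑ i, (m i + 1) - 1) := by
  have : Nonempty (Fin w) := ⟨⟨0, hw⟩⟩
  have h1 := numRow_mul_factorial m w
  have h2 := card_rowSurface (m := m) (X := Fin w) hr
  have h3 := card_symmetric_le (m := m) (X := Fin w) ⟨0, hr⟩
  rw [Nat.card_fin] at h2 h3
  set P := (∏ i, (m i + 1)) with hP
  set q := (∑ i, (m i + 1) - 1).factorial with hq
  have h4 : w.factorial * (numRow m w * (P * q)) =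
      w.factorial * (w.descFactorial (∑ i, (m i + 1)) * numFull (prongTurn m)) +
      Nat.card {p : Perm (Fin w) × RowSurface m (Fin w) // p.1 ≠ 1 ∧ p.1 • p.2 = p.2} *
        (P * q) := by
    calc _ = (numRow m w * w.factorial) * (P * q) := by ring
      _ = Nat.card (RowSurface m (Fin w)) * P * q +
          Nat.card {p : Perm (Fin w) × RowSurface m (Fin w) // p.1 ≠ 1 ∧ p.1 • p.2 = p.2} *
            (P * q) := by rw [h1, add_mul, mul_assoc]
      _ = _ := by rw [h2, mul_assoc]
  constructor
  · refine Nat.le_of_mul_le_mul_left ?_ (Nat.factorial_pos w)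
    rw [h4]
    exact Nat.le_add_right _ _
  · refine Nat.le_of_mul_le_mul_left ?_ (Nat.factorial_pos w)
    rw [h4, mul_add]
    refine Nat.add_le_add_left ((Nat.mul_le_mul_right _ h3).trans (le_of_eq ?_)) _
    ring

open Filter Topology in
/-- The number of surfaces with a single row of `w` squares grows like `w ^ n`. -/
lemma tendsto_numRow (hr : 1 ≤ r) :
    Tendsto (fun w : ℕ => (numRow m w : ℝ) / (w : ℝ) ^ (∑ i, (m i + 1))) atTop
      (𝓝 ((numFull (prongTurn m) : ℝ) /
        ((∏ i, ((m i : ℝ) + 1)) * (∑ i, (m i + 1) - 1).factorial))) := by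
  obtain ⟨n, hn⟩ : ∃ n, ∑ i, (m i + 1) = n + 1 := by
    refine Nat.exists_eq_succ_of_ne_zero (Nat.pos_of_ne_zero ?_).ne'
    intro h
    have := Finset.sum_eq_zero_iff.1 h ⟨0, hr⟩ (Finset.mem_univ _)
    omega
  have hb := fun w hw => numRow_bounds (m := m) hr (w := w) hw
  rw [hn] at hb ⊢
  set N := numFull (prongTurn m)
  set K := (∏ i, (m i + 1)) * (n + 1 - 1).factorial with hK
  set c := (m ⟨0, hr⟩ + 1) ^ 2 with hc
  have hK0 : (0 : ℝ) < K := by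
    have : 0 < K := Nat.mul_pos (Finset.prod_pos fun _ _ => Nat.succ_pos _) (Nat.factorial_pos _)
    exact_mod_cast this
  have hKR : (∏ i, ((m i : ℝ) + 1)) * (n + 1 - 1).factorial = K := by
    rw [hK]; push_cast; rfl
  rw [hKR]
  have hdesc : Tendsto (fun w : ℕ => (w.descFactorial (n + 1) : ℝ) / (w : ℝ) ^ (n + 1)) atTop
      (𝓝 1) := by
    have h := isEquivalent_descFactorial (n + 1)
    refine (Asymptotics.isEquivalent_iff_tendsto_one ?_).1 h
    filter_upwards [eventually_ge_atTop 1] with w hw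
    have : (0 : ℝ) < (w : ℝ) := by exact_mod_cast hw
    positivity
  have hinv : Tendsto (fun w : ℕ => (c : ℝ) * (w : ℝ)⁻¹) atTop (𝓝 0) := by
    simpa using tendsto_inv_atTop_nhds_zero_nat (𝕜 := ℝ) |>.const_mul (c : ℝ)
  have hlow : Tendsto (fun w : ℕ => (w.descFactorial (n + 1) : ℝ) / (w : ℝ) ^ (n + 1) * (N / K))
      atTop (𝓝 (N / K)) := by
    simpa using hdesc.mul_const ((N : ℝ) / K)
  have hup := hlow.add hinv
  rw [add_zero] at hup
  refine tendsto_of_tendsto_of_tendsto_of_le_of_le' hlow hup ?_ ?_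
  · filter_upwards [eventually_ge_atTop 1] with w hw
    have h := (hb w hw).1
    have h' : (w.descFactorial (n + 1) : ℝ) * N ≤ numRow m w * K := by exact_mod_cast h
    have hw0 : (0 : ℝ) < (w : ℝ) ^ (n + 1) := by positivity
    rw [div_mul_div_comm, div_le_div_iff₀ (by positivity) hw0]
    nlinarith
  · filter_upwards [eventually_ge_atTop 1] with w hw
    have h := (hb w hw).2
    have h' : (numRow m w * K : ℝ) ≤ w.descFactorial (n + 1) * N + c * K * w ^ n := by
      exact_mod_cast h
    have hw1 : (0 : ℝ) < (w : ℝ) := by exact_mod_cast hw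
    have hw0 : (0 : ℝ) < (w : ℝ) ^ (n + 1) := by positivity
    rw [div_le_iff₀ hw0]
    refine le_of_mul_le_mul_right (h'.trans (le_of_eq ?_)) hK0
    field_simp
    ring

end NumRow

/-! ### The cycle type of the turn -/

section CycleType

variable {r : ℕ} (m : Fin r → ℕ)

/-- The product of the cycles of length `m i + 1` for `i ∈ s`; those of length `1` are invisible in
`Equiv.Perm.cycleType`. -/
lemma cycleType_sigmaCongrRight (s : Finset (Fin r)) :
    Perm.cycleType (Equiv.sigmaCongrRight
      (fun i => if i ∈ s then finRotate (m i + 1) else 1) : Perm (Prong m)) =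
      (s.val.map fun i => m i + 1).filter (2 ≤ ·) := by
  induction s using Finset.induction_on with
  | empty =>
    have h : (Equiv.sigmaCongrRight (fun i => if i ∈ (∅ : Finset (Fin r)) then finRotate (m i + 1)
        else 1) : Perm (Prong m)) = 1 := by
      ext1 ⟨i, t⟩
      simp
    rw [h]
    simp
  | insert a s ha ih =>
    set E : Perm (Prong m) := (finRotate (m a + 1)).extendDomain (Equiv.sigmaSubtype
      (β := fun i => Fin (m i + 1)) a).symm with hE
    have hEa : ∀ t, E ⟨a, t⟩ = ⟨a, finRotate (m a + 1) t⟩ := fun t =>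
      Perm.extendDomain_apply_image _ (Equiv.sigmaSubtype (β := fun i => Fin (m i + 1)) a).symm t
    have hEn : ∀ i t, i ≠ a → E ⟨i, t⟩ = ⟨i, t⟩ := fun i t hi =>
      Perm.extendDomain_apply_not_subtype _ _ hi
    have h : (Equiv.sigmaCongrRight (fun i => if i ∈ insert a s then finRotate (m i + 1)
        else 1) : Perm (Prong m)) = E * Equiv.sigmaCongrRight
          (fun i => if i ∈ s then finRotate (m i + 1) else 1) := by
      ext1 ⟨i, t⟩
      rw [Perm.mul_apply, sigmaCongrRight_apply, sigmaCongrRight_apply]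
      by_cases hi : i = a
      · subst hi
        simp [ha, hEa]
      · simp [hi, hEn]
    have hdisj : Perm.Disjoint E (Equiv.sigmaCongrRight
        (fun i => if i ∈ s then finRotate (m i + 1) else 1)) := by
      rintro ⟨i, t⟩
      by_cases hi : i = a
      · subst hi
        right
        simp [ha]
      · left
        exact hEn i t hi
    have hct : (finRotate (m a + 1)).cycleType = Multiset.filter (2 ≤ ·) {m a + 1} := by
      by_cases h0 : 2 ≤ m a + 1
      · rw [cycleType_finRotate_of_le h0, Multiset.filter_singleton, if_pos h0]
      · have h1 : finRotate (m a + 1) = 1 := by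
          have hm : m a = 0 := by omega
          rw [hm]
          ext1 x
          exact Subsingleton.elim (α := Fin 1) _ _
        rw [h1, Perm.cycleType_one, Multiset.filter_singleton, if_neg h0]
        rfl
    rw [h, hdisj.cycleType_mul, ih, hE, Perm.cycleType_extendDomain, hct,
      Finset.insert_val_of_notMem ha, Multiset.map_cons, ← Multiset.singleton_add,
      Multiset.filter_add]

/-- The number of factorizations into full cycles depends on the cycle type only. -/
lemma numFull_prongTurn {n : ℕ} (hn : n = ∑ i, (m i + 1)) (ν : Perm (Fin n))
    (hν : ν.partition.parts = Finset.univ.val.map fun i => m i + 1) :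
    numFull (prongTurn m) = numFull ν := by
  have hcard : Fintype.card (Prong m) = n := by
    rw [← Nat.card_eq_fintype_card, card_prong, hn]
  let e := Fintype.equivFinOfCardEq hcard
  have h1 : (prongTurn m).cycleType = ν.cycleType := by
    rw [← Perm.filter_parts_partition_eq_cycleType (σ := ν), hν, ← cycleType_sigmaCongrRight]
    simp [prongTurn]
  have h2 : (e.permCongr (prongTurn m)).cycleType = ν.cycleType := by
    rw [← h1]
    have h3 := Perm.cycleType_extendDomain (p := fun _ : Fin n => True)
      (e.trans (Equiv.Set.univ (Fin n)).symm) (g := prongTurn m)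
    rw [← h3]
    rfl
  obtain ⟨c, hc⟩ := isConj_iff.1 (Perm.isConj_iff_cycleType_eq.2 h2)
  rw [← numFull_permCongr e, ← numFull_permCongr c, ← hc]
  rfl

end CycleType

/-! ### Asymptotics of sums over divisors -/

section Asymptotics

open Filter Topology Finset

/-- The Stolz–Cesàro theorem for the comparison sequence `x ^ (p + 1)`, whose increments are
asymptotic to `(p + 1) x ^ p`. -/
lemma tendsto_sum_div_pow {u : ℕ → ℝ} {p : ℕ} {a : ℝ}
    (hu : Tendsto (fun w : ℕ => u w / (w : ℝ) ^ p) atTop (𝓝 a)) :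
    Tendsto (fun x : ℕ => (∑ w ∈ range x, u (w + 1)) / (x : ℝ) ^ (p + 1)) atTop
      (𝓝 (a / (p + 1))) := by
  set G : ℕ → ℝ := fun w => ((w + 1 : ℕ) : ℝ) ^ (p + 1) - (w : ℝ) ^ (p + 1) with hG
  have hG0 : ∀ w, 0 < G w := by
    intro w
    have : (w : ℝ) < ((w + 1 : ℕ) : ℝ) := by push_cast; linarith
    exact sub_pos.2 (pow_lt_pow_left₀ this (Nat.cast_nonneg w) (Nat.succ_ne_zero p))
  have hGsum : ∀ x, ∑ w ∈ range x, G w = (x : ℝ) ^ (p + 1) := by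
    intro x
    rw [Finset.sum_range_sub (fun w : ℕ => (w : ℝ) ^ (p + 1))]
    simp
  -- `G w` is the sum of `p + 1` products of `p` factors `w` or `w + 1`
  have hG1 : Tendsto (fun w : ℕ => G w / ((w + 1 : ℕ) : ℝ) ^ p) atTop (𝓝 (p + 1)) := by
    have hq : Tendsto (fun w : ℕ => (w : ℝ) / ((w + 1 : ℕ) : ℝ)) atTop (𝓝 1) := by
      simpa using tendsto_natCast_div_add_atTop (1 : ℝ)
    have h1 : Tendsto (fun w : ℕ => ∑ i ∈ range (p + 1), ((w : ℝ) / ((w + 1 : ℕ) : ℝ)) ^ (p - i))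
        atTop (𝓝 (∑ i ∈ range (p + 1), (1 : ℝ) ^ (p - i))) :=
      tendsto_finsetSum _ fun i _ => hq.pow _
    have h2 : ∑ i ∈ range (p + 1), (1 : ℝ) ^ (p - i) = p + 1 := by simp
    rw [h2] at h1
    refine h1.congr fun w => ?_
    have hw : ((w + 1 : ℕ) : ℝ) ≠ 0 := Nat.cast_ne_zero.2 (Nat.succ_ne_zero w)
    have h3 := (geom_sum₂_mul ((w + 1 : ℕ) : ℝ) (w : ℝ) (p + 1)).symm
    have h4 : ((w + 1 : ℕ) : ℝ) - w = 1 := by push_cast; ring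
    rw [h4, mul_one] at h3
    rw [hG]
    simp only
    rw [h3, Finset.sum_div]
    refine Finset.sum_congr rfl fun i hi => ?_
    have hi' : i ≤ p := Nat.lt_succ_iff.1 (Finset.mem_range.1 hi)
    rw [div_pow, Nat.add_sub_cancel, div_eq_div_iff (pow_ne_zero _ hw) (pow_ne_zero _ hw)]
    have h5 : ((w + 1 : ℕ) : ℝ) ^ p = ((w + 1 : ℕ) : ℝ) ^ i * ((w + 1 : ℕ) : ℝ) ^ (p - i) := by
      rw [← pow_add, Nat.add_sub_cancel' hi']
    rw [h5]
    ring
  set b : ℝ := a / (p + 1) with hb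
  have hv : Tendsto (fun w : ℕ => u (w + 1) / G w) atTop (𝓝 b) := by
    have h1 := (hu.comp (tendsto_add_atTop_nat 1)).div hG1 (by positivity)
    refine h1.congr fun w => ?_
    have hw : ((w + 1 : ℕ) : ℝ) ≠ 0 := Nat.cast_ne_zero.2 (Nat.succ_ne_zero w)
    simp only [Function.comp_apply, Pi.div_apply]
    rw [div_div_div_cancel_right₀ (pow_ne_zero _ hw)]
  have hlo : (fun w : ℕ => u (w + 1) - b * G w) =o[atTop] G := by
    rw [Asymptotics.isLittleO_iff_tendsto (fun w hw => absurd hw (hG0 w).ne')]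
    have h1 := hv.sub_const b
    rw [sub_self] at h1
    refine h1.congr fun w => ?_
    rw [sub_div, mul_div_cancel_right₀ _ (hG0 w).ne']
  have hsum := hlo.sum_range (fun w => (hG0 w).le) (by
    simp_rw [hGsum]
    exact (tendsto_pow_atTop (Nat.succ_ne_zero p)).comp tendsto_natCast_atTop_atTop)
  have hsum' := hsum.tendsto_div_nhds_zero.add_const b
  rw [zero_add] at hsum'
  refine hsum'.congr' ?_
  filter_upwards [eventually_ge_atTop 1] with x hx
  have hx0 : (x : ℝ) ^ (p + 1) ≠ 0 := pow_ne_zero _ (Nat.cast_ne_zero.2 (by omega))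
  rw [Finset.sum_sub_distrib, ← Finset.mul_sum, hGsum, sub_div, mul_div_cancel_right₀ _ hx0]
  ring

/-- The sum over all `w h ≤ N`, arranged by `h`; here `w` and `h` are shifted by one to run through
ranges. -/
lemma sum_Icc_divisors (u : ℕ → ℝ) (N : ℕ) :
    ∑ M ∈ Icc 1 N, ∑ w ∈ M.divisors, u w = ∑ h ∈ range N, ∑ w ∈ range (N / (h + 1)), u (w + 1) := by
  rw [Finset.sum_sigma', Finset.sum_sigma']
  refine Finset.sum_bij' (fun p _ => ⟨p.1 / p.2 - 1, p.2 - 1⟩)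
    (fun p _ => ⟨(p.1 + 1) * (p.2 + 1), p.2 + 1⟩) ?_ ?_ ?_ ?_ ?_
  · rintro ⟨M, w⟩ h
    simp only [mem_sigma, mem_Icc, Nat.mem_divisors, mem_range] at h ⊢
    obtain ⟨⟨h1, h2⟩, ⟨k, rfl⟩, h0⟩ := h
    have hw : 0 < w := Nat.pos_of_ne_zero (by rintro rfl; simp at h0)
    have hk : 0 < k := Nat.pos_of_ne_zero (by rintro rfl; simp at h0)
    rw [Nat.mul_div_cancel_left _ hw, Nat.sub_add_cancel hk]
    have h3 : w ≤ N / k := (Nat.le_div_iff_mul_le hk).2 h2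
    have h4 : k ≤ N := le_trans (Nat.le_mul_of_pos_left k hw) h2
    omega
  · rintro ⟨h, w⟩ hp
    simp only [mem_sigma, mem_Icc, Nat.mem_divisors, mem_range] at hp ⊢
    have h3 := (Nat.le_div_iff_mul_le (Nat.succ_pos h)).1 (Nat.succ_le_of_lt hp.2)
    refine ⟨⟨Nat.mul_pos (Nat.succ_pos _) (Nat.succ_pos _), ?_⟩, ⟨h + 1, mul_comm _ _⟩,
      Nat.mul_ne_zero (Nat.succ_ne_zero _) (Nat.succ_ne_zero _)⟩
    rw [mul_comm]
    exact h3
  · rintro ⟨M, w⟩ h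
    simp only [mem_sigma, mem_Icc, Nat.mem_divisors] at h ⊢
    obtain ⟨⟨h1, h2⟩, ⟨k, rfl⟩, h0⟩ := h
    have hw : 0 < w := Nat.pos_of_ne_zero (by rintro rfl; simp at h0)
    have hk : 0 < k := Nat.pos_of_ne_zero (by rintro rfl; simp at h0)
    rw [Nat.mul_div_cancel_left _ hw, Nat.sub_add_cancel hk, Nat.sub_add_cancel hw, mul_comm]
  · rintro ⟨h, w⟩ _
    simp only
    rw [Nat.mul_div_cancel _ (Nat.succ_pos w)]
    rfl
  · rintro ⟨M, w⟩ h
    simp only [mem_sigma, mem_Icc, Nat.mem_divisors] at h ⊢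
    rw [Nat.sub_add_cancel]
    exact Nat.pos_of_dvd_of_pos h.2.1 h.1.1

/-- If `u w` grows like `a w ^ p`, then the sum of `u w` over all `w h ≤ N` grows like
`a ζ(p + 1) N ^ (p + 1) / (p + 1)`. -/
theorem tendsto_sum_divisors {u : ℕ → ℝ} {p : ℕ} (hp : 1 ≤ p) {a : ℝ}
    (hu : Tendsto (fun w : ℕ => u w / (w : ℝ) ^ p) atTop (𝓝 a)) :
    Tendsto (fun N : ℕ => (∑ M ∈ Icc 1 N, ∑ w ∈ M.divisors, u w) / (N : ℝ) ^ (p + 1)) atTop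
      (𝓝 (a / (p + 1) * ∑' h : ℕ, 1 / ((h + 1 : ℕ) : ℝ) ^ (p + 1))) := by
  set S : ℕ → ℝ := fun x => ∑ w ∈ range x, u (w + 1) with hS
  have hSt : Tendsto (fun x : ℕ => S x / (x : ℝ) ^ (p + 1)) atTop (𝓝 (a / (p + 1))) :=
    tendsto_sum_div_pow hu
  obtain ⟨C, hC⟩ : ∃ C : ℝ, ∀ x : ℕ, |S x| ≤ C * (x : ℝ) ^ (p + 1) := by
    obtain ⟨C, hC⟩ := hSt.abs.bddAbove_range
    refine ⟨C, fun x => ?_⟩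
    rcases Nat.eq_zero_or_pos x with rfl | hx
    · simp [hS]
    · have hx0 : (0 : ℝ) < (x : ℝ) ^ (p + 1) := pow_pos (Nat.cast_pos.2 hx) _
      have h1 : |S x / (x : ℝ) ^ (p + 1)| ≤ C := hC ⟨x, rfl⟩
      rwa [abs_div, abs_of_pos hx0, div_le_iff₀ hx0] at h1
  have hC0 : 0 ≤ C := by
    have := (abs_nonneg _).trans (hC 1)
    simpa using this
  have hsummable : Summable fun h : ℕ => 1 / ((h + 1 : ℕ) : ℝ) ^ (p + 1) :=
    (summable_nat_add_iff 1).2 (Real.summable_one_div_nat_pow.2 (by omega))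
  -- the summands are dominated by those of the convergent series for `C ζ(p + 1)`
  have key : Tendsto (fun N : ℕ => ∑' h : ℕ, S (N / (h + 1)) / (N : ℝ) ^ (p + 1)) atTop
      (𝓝 (∑' h : ℕ, a / (p + 1) * (1 / ((h + 1 : ℕ) : ℝ) ^ (p + 1)))) := by
    refine tendsto_tsum_of_dominated_convergence (hsummable.mul_left C) (fun h => ?_) ?_
    · have hh : (0 : ℝ) < ((h + 1 : ℕ) : ℝ) := Nat.cast_pos.2 (Nat.succ_pos h)
      have h1 : Tendsto (fun N : ℕ => N / (h + 1)) atTop atTop :=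
        Nat.tendsto_div_const_atTop (Nat.succ_ne_zero h)
      have h2 : Tendsto (fun N : ℕ => ((N / (h + 1) : ℕ) : ℝ) / N) atTop
          (𝓝 (1 / ((h + 1 : ℕ) : ℝ))) := by
        have h3 := (tendsto_nat_floor_mul_div_atTop (R := ℝ) (a := 1 / ((h + 1 : ℕ) : ℝ))
          (by positivity)).comp tendsto_natCast_atTop_atTop
        refine h3.congr fun N => ?_
        simp only [Function.comp_apply]
        rw [one_div_mul_eq_div, Nat.floor_div_eq_div]
      have h4 := (hSt.comp h1).mul (h2.pow (p + 1))
      rw [div_pow, one_pow] at h4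
      refine h4.congr' ?_
      filter_upwards [eventually_ge_atTop (h + 1)] with N hN
      have h5 : ((N / (h + 1) : ℕ) : ℝ) ≠ 0 := by
        have := Nat.div_pos hN (Nat.succ_pos h)
        exact Nat.cast_ne_zero.2 this.ne'
      simp only [Function.comp_apply]
      rw [div_pow, div_mul_div_cancel₀ (pow_ne_zero _ h5)]
    · filter_upwards [eventually_ge_atTop 1] with N hN h
      have hN0 : (0 : ℝ) < (N : ℝ) := Nat.cast_pos.2 hN
      have hh : (0 : ℝ) < ((h + 1 : ℕ) : ℝ) := Nat.cast_pos.2 (Nat.succ_pos h)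
      rw [Real.norm_eq_abs, abs_div, abs_of_pos (pow_pos hN0 (p + 1)),
        div_le_iff₀ (pow_pos hN0 _)]
      refine (hC _).trans ?_
      rw [mul_assoc]
      refine mul_le_mul_of_nonneg_left ?_ hC0
      rw [one_div_mul_eq_div, ← div_pow]
      exact pow_le_pow_left₀ (Nat.cast_nonneg _) Nat.cast_div_le _
  rw [tsum_mul_left] at key
  refine key.congr fun N => ?_
  rw [sum_Icc_divisors, Finset.sum_div]
  refine tsum_eq_sum fun h hh => ?_
  have h1 : N / (h + 1) = 0 := Nat.div_eq_of_lt (by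
    rw [Finset.mem_range, not_lt] at hh
    omega)
  rw [h1, hS]
  simp

end Asymptotics

/-! ### The contribution of the one-cylinder surfaces -/

lemma count_one_eq {r : ℕ} (m : Fin r → ℕ) (hr : 1 ≤ r) (N : ℕ) :
    count m 1 N = ∑ M ∈ Finset.Icc 1 N, ∑ w ∈ M.divisors, numRow m w :=
  Finset.sum_congr rfl fun _ hM =>
    ncard_oneCylinder m hr (Nat.one_le_iff_ne_zero.1 (Finset.mem_Icc.1 hM).1)

lemma prod_image_mult {r : ℕ} (m : Fin r → ℕ) :
    ∏ k ∈ Finset.univ.image m, 1 / ((k : ℂ) + 1) ^ mult m k = (∏ i, ((m i : ℂ) + 1))⁻¹ := by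
  rw [Finset.prod_comp (fun k : ℕ => (k : ℂ) + 1) m, ← Finset.prod_inv_distrib]
  exact Finset.prod_congr rfl fun k _ => one_div _

lemma ofReal_tsum_eq_riemannZeta (p : ℕ) (hp : 1 ≤ p) :
    ((∑' h : ℕ, 1 / ((h + 1 : ℕ) : ℝ) ^ (p + 1) : ℝ) : ℂ) = riemannZeta ((p : ℂ) + 1) := by
  have h1 := zeta_nat_eq_tsum_of_gt_one (k := p + 1) (by omega)
  have hs : Summable fun n : ℕ => 1 / (n : ℝ) ^ (p + 1) :=
    Real.summable_one_div_nat_pow.2 (by omega)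
  have h2 := hs.tsum_eq_zero_add
  rw [Nat.cast_zero, zero_pow (Nat.succ_ne_zero p), div_zero, zero_add] at h2
  rw [← h2, Complex.ofReal_tsum]
  push_cast at h1 ⊢
  exact h1.symm

end SquareTiled

theorem theorem2p3 (r g n d : ℕ) (m : Fin r → ℕ) (hr : 1 ≤ r)
    (hg : ∑ i, m i + 2 = 2 * g) (hd : d + 1 = 2 * g + r) (hn : n = ∑ i, (m i + 1))
    (ν : Equiv.Perm (Fin n))
    (hν : ν.partition.parts = Finset.univ.val.map fun i => m i + 1) :
    n + 1 = d ∧ ∃ c : ℝ, SquareTiled.IsContribution m d 1 c ∧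
      (c : ℂ) = 2 / (n.factorial : ℂ) *
        (∏ k ∈ Finset.univ.image m, 1 / ((k : ℂ) + 1) ^ SquareTiled.mult m k) *
        (∑ j ∈ Finset.range n,
          (j.factorial : ℂ) * ((n - 1 - j).factorial : ℂ) * SquareTiled.chi n j ν) *
        riemannZeta ((n : ℂ) + 1) := by
  have hn' : n = ∑ i, m i + r := by
    rw [hn, Finset.sum_add_distrib]
    simp
  have hnd : n + 1 = d := by omega
  have hn1 : 1 ≤ n := by omega
  refine ⟨hnd, ?_⟩
  set A : ℝ := (SquareTiled.numFull ν : ℝ) / ((∏ i, ((m i : ℝ) + 1)) * (n - 1).factorial) with hA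
  have hrow : Filter.Tendsto (fun w : ℕ => (SquareTiled.numRow m w : ℝ) / (w : ℝ) ^ n)
      Filter.atTop (nhds A) := by
    have h := SquareTiled.tendsto_numRow (m := m) hr
    rwa [SquareTiled.numFull_prongTurn m hn ν hν, ← hn] at h
  refine ⟨2 * d * (A / (n + 1) * ∑' h : ℕ, 1 / ((h + 1 : ℕ) : ℝ) ^ (n + 1)), ?_, ?_⟩
  · have h := SquareTiled.tendsto_sum_divisors hn1 hrow
    unfold SquareTiled.IsContribution
    subst hnd
    refine (h.const_mul _).congr fun N => ?_
    rw [SquareTiled.count_one_eq m hr]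
    push_cast
    rfl
  · have hfac : (n.factorial : ℂ) = n * ((n - 1).factorial : ℂ) := by
      exact_mod_cast (Nat.mul_factorial_pred (by omega : n ≠ 0)).symm
    have hn0 : (n : ℂ) ≠ 0 := Nat.cast_ne_zero.2 (by omega)
    have hn2 : (n : ℂ) + 1 ≠ 0 := Nat.cast_add_one_ne_zero n
    have hf0 : ((n - 1).factorial : ℂ) ≠ 0 := Nat.cast_ne_zero.2 (Nat.factorial_ne_zero _)
    have hP : (∏ i, ((m i : ℂ) + 1)) ≠ 0 :=
      Finset.prod_ne_zero_iff.2 fun i _ => Nat.cast_add_one_ne_zero (m i)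
    rw [SquareTiled.prod_image_mult, ← SquareTiled.numFull_eq hn1 ν, hfac,
      ← SquareTiled.ofReal_tsum_eq_riemannZeta n hn1, ← hnd, hA]
    generalize (∑' h : ℕ, 1 / ((h + 1 : ℕ) : ℝ) ^ (n + 1)) = Z
    push_cast
    field_simp
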